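/- Let $V$ be a real Hilbert space, $\mu$ a $\sigma$-finite measure on a measurable space $\Omega$, $m,n\in\mathbb N$, and $S^2:=L^2(\mu)^m$. Let $A:S^2\to (S^2)^\star$ be bounded, linear, symmetric and coercive, $B:S^2\to V^\star$ bounded and linear, and $\mathcal D:\mathbb R^m\to\mathbb R^n$ linear. Put $$K:=\{\Sigma\in S^2:\ |\mathcal D\Sigma|\le 1\ \text{a.e.}\},\qquad H:=\{\Sigma\in S^2:\ |\mathcal D\Sigma|=0\ \text{a.e.}\},$$ and assume that the restriction $B|_H:H\to V^\star$ is surjective. For $\ell\in V^\star$ let $\Sigma_\ell$ be the unique solution of $$\text{minimize } \tfrac12\langle A\Sigma,\Sigma\rangle\quad\text{such that } B\Sigma=\ell,\ \Sigma\in K,$$ and let $u_\ell\in V$ be the unique multiplier with $$\langle A\Sigma_\ell+B^\star u_\ell,\,T-\Sigma_\ell\rangle-\langle B\Sigma_\ell-\ell,\,v-u_\ell\rangle\ge 0\qquad\forall (T,v)\in K\times V$$ (both exist and are unique). For $j:S^2\to(-\infty,\infty]$, $x$ with $j(x)<\infty$, and $g\in (S^2)^\star$, the weak second subderivative is $$Q_j^{x,g}(z):=\inf\Big\{\liminf_{k\to\infty}\frac{j(x+t_kz_k)-j(x)-t_k\langle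 g,z_k\rangle}{t_k^2/2}\ :\ t_k\searrow 0,\ z_k\rightharpoonup z\Big\},$$ and the reduced critical cone is $\mathcal K_j^{x,g}:=\{z: Q_j^{x,g}(z)<+\infty\}$. Let $\delta_K$ be the indicator function of $K$ ($0$ on $K$, $+\infty$ elsewhere). **Theorem.** Let $\ell_0\in V^\star$ and $\Xi_{\ell_0}:=-(A\Sigma_{\ell_0}+B^\star u_{\ell_0})$. There is a unique $\lambda_0\in L^2(\mu)$ with $\lambda_0\ge 0$ a.e., $\lambda_0=0$ a.e. on $\{|\mathcal D\Sigma_{\ell_0}|\neq 1\}$, and $$A\Sigma_{\ell_0}+B^\star u_{\ell_0}+\lambda_0\,\mathcal D^\star\mathcal D\Sigma_{\ell_0}=0 .$$ With $\mathcal K:=\mathcal K_{\delta_K}^{\Sigma_{\ell_0},\Xi_{\ell_0}}$, the function $\lambda_0\langle\mathcal D T_1,\mathcal D T_2\rangle_{\mathbb R^n}$ is $\mu$-integrable for all $T_1,T_2\in\mathcal K$. The map $V^\star\ni\ell\mapsto(\Sigma_\ell,u_\ell)\in S^2\times V$ is strongly Hadamard directionally differentiable in $\ell_0$: for every $\delta\ell\in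 V^\star$ there is $(\Sigma',u')\in S^2\times V$ such that, for every family $(q_t)_{t>0}\subset V^\star$ with $q_t\to\delta\ell$ as $t\searrow0$, $$\frac{(\Sigma_{\ell_0+tq_t},u_{\ell_0+tq_t})-(\Sigma_{\ell_0},u_{\ell_0})}{t}\to(\Sigma',u')\quad\text{strongly in } S^2\times V\text{ as } t\searrow 0 .$$ Moreover, $(\Sigma',u')$ is the unique element of $\mathcal K\times V$ satisfying $$\langle A\Sigma'+B^\star u',\,T-\Sigma'\rangle+\int_\Omega\lambda_0\,\langle\mathcal D\Sigma',\mathcal D(T-\Sigma')\rangle_{\mathbb R^n}\,d\mu-\langle B\Sigma'-\delta\ell,\,v-u'\rangle\ge 0\qquad\forall (T,v)\in\mathcal K\times V .$$ -/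

import Mathlib

open MeasureTheory Filter Topology

noncomputable section

namespace Elastoplasticity

section Abstract

variable {X : Type*} [NormedAddCommGroup X] [NormedSpace ℝ X]

/-- Weak convergence of a sequence in a normed space. -/
def WeaklyConverges (z : ℕ → X) (z₀ : X) : Prop :=
  ∀ φ : StrongDual ℝ X, Tendsto (fun k => φ (z k)) atTop (𝓝 (φ z₀))

/-- The weak second subderivative of `j` in `x` for `g`: the infimum of the lower limits of the
second-order difference quotients over all `t k → 0`, `t k > 0`, and all weakly convergent
sequences `z k ⇀ z`. In a reflexive space (the only case used) the weak and the weak-star topology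
agree. -/
def secondSubderivative (j : X → EReal) (x : X) (g : StrongDual ℝ X) (z : X) : EReal :=
  sInf {r : EReal | ∃ (t : ℕ → ℝ) (w : ℕ → X), (∀ k, 0 < t k) ∧ Tendsto t atTop (𝓝 0) ∧
    WeaklyConverges w z ∧
    r = liminf (fun k =>
      (j (x + t k • w k) - j x - ((t k * g (w k) : ℝ) : EReal)) / (((t k) ^ 2 / 2 : ℝ) : EReal))
      atTop}

/-- The reduced critical cone: the domain of the second subderivative. -/
def reducedCriticalCone (j : X → EReal) (x : X) (g : StrongDual ℝ X) : Set X :=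
  {z | secondSubderivative j x g z < ⊤}

open Classical in
/-- The indicator function of convex analysis: `0` on `K` and `+∞` off `K`. -/
def indicatorFunction (K : Set X) (x : X) : EReal := if x ∈ K then 0 else ⊤

/-- `F` has the strong Hadamard directional derivative `y` at `p` in direction `δ`: the difference
quotients converge in norm for all families of directions `q t → δ` as `t` decreases to `0`. -/
def HasHadamardDirDeriv {P : Type*} [NormedAddCommGroup P] [NormedSpace ℝ P]
    (F : P → X) (p δ : P) (y : X) : Prop :=
  ∀ q : ℝ → P, Tendsto q (𝓝[>] 0) (𝓝 δ) →
    Tendsto (fun t : ℝ => t⁻¹ • (F (p + t • q t) - F p)) (𝓝[>] 0) (𝓝 y)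

end Abstract

section Setting

variable {Ω : Type*} [MeasurableSpace Ω]

/-- The Hilbert space `S² = L²(μ)^m = L²(μ; ℝ^m)`. -/
abbrev StressSpace (μ : Measure Ω) (m : ℕ) : Type _ := Lp (EuclideanSpace ℝ (Fin m)) 2 μ

variable {μ : Measure Ω} {m n : ℕ} {V : Type*} [NormedAddCommGroup V] [InnerProductSpace ℝ V]

/-- The set `K` of admissible stresses: `|D S| ≤ 1` a.e. -/
def admissibleSet (μ : Measure Ω) (D : EuclideanSpace ℝ (Fin m) →ₗ[ℝ] EuclideanSpace ℝ (Fin n)) :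
    Set (StressSpace μ m) :=
  {S | ∀ᵐ x ∂μ, ‖D (S x)‖ ≤ 1}

/-- The space `H` of all `S` with `D S = 0` a.e. -/
def deviatorKernel (μ : Measure Ω) (D : EuclideanSpace ℝ (Fin m) →ₗ[ℝ] EuclideanSpace ℝ (Fin n)) :
    Set (StressSpace μ m) :=
  {S | ∀ᵐ x ∂μ, ‖D (S x)‖ = 0}

/-- `S` solves: minimize `½ ⟨A S, S⟩` such that `B S = ℓ` and `S ∈ K`. -/
def IsStressSolution (A : StressSpace μ m →L[ℝ] StrongDual ℝ (StressSpace μ m))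
    (B : StressSpace μ m →L[ℝ] StrongDual ℝ V)
    (D : EuclideanSpace ℝ (Fin m) →ₗ[ℝ] EuclideanSpace ℝ (Fin n))
    (ℓ : StrongDual ℝ V) (S : StressSpace μ m) : Prop :=
  S ∈ admissibleSet μ D ∧ B S = ℓ ∧
    ∀ T ∈ admissibleSet μ D, B T = ℓ → (1 / 2 : ℝ) * A S S ≤ (1 / 2 : ℝ) * A T T

/-- `(S, u)` satisfies the saddle-point variational inequality
`⟨A S + B⋆ u, T - S⟩ - ⟨B S - ℓ, v - u⟩ ≥ 0` for all `(T, v) ∈ K × V`. Here `B⋆ u = B.flip u`. -/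
def SaddlePointVI (A : StressSpace μ m →L[ℝ] StrongDual ℝ (StressSpace μ m))
    (B : StressSpace μ m →L[ℝ] StrongDual ℝ V)
    (D : EuclideanSpace ℝ (Fin m) →ₗ[ℝ] EuclideanSpace ℝ (Fin n))
    (ℓ : StrongDual ℝ V) (S : StressSpace μ m) (u : V) : Prop :=
  ∀ T ∈ admissibleSet μ D, ∀ v : V,
    0 ≤ (A S + B.flip u) (T - S) - (B S - ℓ) (v - u)

/-- `lam ≥ 0` vanishes a.e. off `{|D S| = 1}` and `A S + B⋆ u + lam D⋆ D S = 0`, an equation in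
the dual of `S²`. -/
def IsPlasticMultiplier (A : StressSpace μ m →L[ℝ] StrongDual ℝ (StressSpace μ m))
    (B : StressSpace μ m →L[ℝ] StrongDual ℝ V)
    (D : EuclideanSpace ℝ (Fin m) →ₗ[ℝ] EuclideanSpace ℝ (Fin n))
    (S : StressSpace μ m) (u : V) (lam : Lp ℝ 2 μ) : Prop :=
  (∀ᵐ x ∂μ, 0 ≤ lam x) ∧ (∀ᵐ x ∂μ, ‖D (S x)‖ ≠ 1 → lam x = 0) ∧
    ∀ T : StressSpace μ m,
      (A S + B.flip u) T + ∫ x, inner ℝ (lam x • LinearMap.adjoint D (D (S x))) (T x) ∂μ = 0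

/-- The reduced critical cone of the indicator function of `K` in `S` for `Ξ = -(A S + B⋆ u)`. -/
def plasticCone (A : StressSpace μ m →L[ℝ] StrongDual ℝ (StressSpace μ m))
    (B : StressSpace μ m →L[ℝ] StrongDual ℝ V)
    (D : EuclideanSpace ℝ (Fin m) →ₗ[ℝ] EuclideanSpace ℝ (Fin n))
    (S : StressSpace μ m) (u : V) : Set (StressSpace μ m) :=
  reducedCriticalCone (indicatorFunction (admissibleSet μ D)) S (-(A S + B.flip u))

/-- `(S', u')` solves the linearized saddle-point variational inequality on `C × V` with curvature
term `∫ lam ⟨D S', D (T - S')⟩ dμ` and right-hand side `δℓ`. -/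
def IsLinearizedSolution (A : StressSpace μ m →L[ℝ] StrongDual ℝ (StressSpace μ m))
    (B : StressSpace μ m →L[ℝ] StrongDual ℝ V)
    (D : EuclideanSpace ℝ (Fin m) →ₗ[ℝ] EuclideanSpace ℝ (Fin n))
    (C : Set (StressSpace μ m)) (lam : Lp ℝ 2 μ) (δℓ : StrongDual ℝ V)
    (S' : StressSpace μ m) (u' : V) : Prop :=
  S' ∈ C ∧ ∀ T ∈ C, ∀ v : V,
    0 ≤ (A S' + B.flip u') (T - S')
      + ∫ x, lam x * inner ℝ (D (S' x)) (D ((T - S' : StressSpace μ m) x)) ∂μ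
      - (B S' - δℓ) (v - u')

end Setting

end Elastoplasticity

end

/-!
Kernel directions of `D` leave the constraint `|D σ| ≤ 1` untouched and reach every load. A bounded
right inverse `R` of `B` with values in this kernel therefore decouples stress and multiplier:
testing with `R φ` gives `φ u = -⟨A Σ, R φ⟩`, so `u` is a continuous linear function of the
stress (`exists_multiplierMap`), and everything reduces to minimization problems for stresses.

The pointwise geometry enters through `exists_recovery`. Projecting `D (Σ + t z)` radially onto the
unit ball, for a direction `z` that is tangential almost everywhere, yields admissible difference
quotients that converge to `z` in norm and whose first-order cost is at most the curvature of the
sphere. Applied to suitable test directions it produces the multiplier `λ` in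
`Ξ = λ D⋆ D Σ` (`exists_isNormalMultiplier`), and it gives the upper bound for the second
subderivative. The matching lower bound is `curvature_le_of_admissible`: admissible difference
quotients `w` satisfy `∫ λ |D w|² ≤ -(2 / t) Ξ w`. Since sublevel sets of the curvature are closed
and convex, hence weakly sequentially closed, the reduced critical cone consists of the tangential
`z` with `Ξ z = 0` and `∫ λ |D z|² < ∞` (`reducedCriticalCone_eq_curvatureCone`).

Difference quotients `σ` of the stress minimize `⟨A σ, σ⟩ - (2 / t) Ξ σ` over admissible steps. For
`t ≤ 2 / N` this is at least `⟨A σ, σ⟩ + max (∫ λ |D σ|²) (-N Ξ σ)`. These lower bounds are strongly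
convex and increase with `N` to the energy `⟨A σ, σ⟩ + ∫ λ |D σ|²` on the cone, with value `∞` off
it. Together with the recovery sequence, `exists_minimizer_iSup` turns this into norm convergence to
the minimizer of the limit (`exists_stress_derivative`). No weak compactness is needed, because
near-minimizers of strongly convex functionals are Cauchy once the minimal values converge. The
first-order condition of the limit problem is the linearized inequality
(`isLinearizedSolution_iff`).
-/

noncomputable section

namespace Elastoplasticity

/-! ### Convex analysis in Banach and Hilbert spaces -/

theorem exists_continuousLinear_rightInverse {E F : Type*} [NormedAddCommGroup E]
    [InnerProductSpace ℝ E] [CompleteSpace E] [NormedAddCommGroup F] [NormedSpace ℝ F]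
    [CompleteSpace F] (f : E →L[ℝ] F) (hf : Function.Surjective f) :
    ∃ g : F →L[ℝ] E, ∀ y, f (g y) = y := by
  let N : Submodule ℝ E := LinearMap.ker (f : E →ₗ[ℝ] F)
  have hN : IsClosed (N : Set E) := f.isClosed_ker
  have : CompleteSpace N := hN.completeSpace_coe
  let h : Nᗮ →L[ℝ] F := f.comp Nᗮ.subtypeL
  have hinj : LinearMap.ker (h : Nᗮ →ₗ[ℝ] F) = ⊥ := by
    rw [LinearMap.ker_eq_bot']
    intro x hx
    have h1 : (x : E) ∈ N := hx
    exact Subtype.ext (Submodule.disjoint_def.1 N.orthogonal_disjoint _ h1 x.2)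
  have hsurj : LinearMap.range (h : Nᗮ →ₗ[ℝ] F) = ⊤ := by
    rw [LinearMap.range_eq_top]
    intro y
    obtain ⟨x, rfl⟩ := hf y
    obtain ⟨a, ha, b, hb, rfl⟩ := N.exists_add_mem_mem_orthogonal x
    refine ⟨⟨b, hb⟩, ?_⟩
    have h1 : f a = 0 := ha
    simp [h, h1]
  let e := ContinuousLinearEquiv.ofBijective h hinj hsurj
  refine ⟨Nᗮ.subtypeL.comp (e.symm : F →L[ℝ] Nᗮ), fun y => ?_⟩
  exact ContinuousLinearEquiv.ofBijective_apply_symm_apply h hinj hsurj y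

/-- Closed convex sets are weakly sequentially closed, even if the sequence returns to the set only
infinitely often. -/
theorem mem_of_weaklyConverges_of_frequently {X : Type*} [NormedAddCommGroup X] [NormedSpace ℝ X]
    {C : Set X} (hconv : Convex ℝ C) (hclosed : IsClosed C) {w : ℕ → X} {z : X}
    (hw : WeaklyConverges w z) (hmem : ∃ᶠ k in atTop, w k ∈ C) : z ∈ C := by
  by_contra hz
  obtain ⟨f, r, hf, hr⟩ := geometric_hahn_banach_closed_point hconv hclosed hz
  obtain ⟨k, hk, hk'⟩ := (hmem.and_eventually ((hw f).eventually (lt_mem_nhds hr))).exists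
  exact lt_asymm (hf _ hk) hk'

/-- First-order condition extracted from a quadratic minimum along a segment. -/
theorem nonneg_of_forall_mul_add_sq_mul_nonneg {a b : ℝ}
    (h : ∀ θ : ℝ, 0 < θ → θ ≤ 1 → 0 ≤ θ * a + θ ^ 2 * b) : 0 ≤ a := by
  have hlim : Tendsto (fun θ : ℝ => a + θ * b) (𝓝[>] 0) (𝓝 (a + 0 * b)) :=
    ((continuous_const.add (continuous_id.mul continuous_const)).tendsto 0).mono_left
      nhdsWithin_le_nhds
  rw [zero_mul, add_zero] at hlim
  refine ge_of_tendsto hlim ?_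
  filter_upwards [Ioc_mem_nhdsGT one_pos] with θ hθ
  have h1 := h θ hθ.1 hθ.2
  have h2 : θ * a + θ ^ 2 * b = θ * (a + θ * b) := by ring
  rw [h2] at h1
  exact nonneg_of_mul_nonneg_right h1 hθ.1

/-- An increasing sequence of lower semicontinuous, uniformly strongly convex functionals on a
closed convex set has a supremum with a minimizer `z`, and every family along which each single
functional is asymptotically at most the minimum converges to `z` in norm. Near-minimizers of
the functionals are Cauchy by strong convexity, so no weak compactness is involved. -/
theorem exists_minimizer_iSup {X : Type*} [NormedAddCommGroup X] [NormedSpace ℝ X]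
    [CompleteSpace X] {C : Set X} (hC : IsClosed C)
    (hmid : ∀ a ∈ C, ∀ b ∈ C, midpoint ℝ a b ∈ C) {G : ℕ → X → ENNReal} (hmono : Monotone G)
    (hlsc : ∀ N, LowerSemicontinuous (G N)) {c : ℝ} (hc : 0 < c)
    (hconv : ∀ N, ∀ a ∈ C, ∀ b ∈ C,
      G N (midpoint ℝ a b) + ENNReal.ofReal (c * ‖a - b‖ ^ 2) ≤ (G N a + G N b) / 2)
    {x₀ : X} (hx₀ : x₀ ∈ C) (hfin : ⨆ N, G N x₀ ≠ ⊤) :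
    ∃ z ∈ C, (∀ x ∈ C, ⨆ N, G N z ≤ ⨆ N, G N x) ∧
      ∀ (l : Filter ℝ) (x : ℝ → X), (∀ᶠ t in l, x t ∈ C) →
        (∀ N, ∀ ε : ℝ, 0 < ε → ∀ᶠ t in l, G N (x t) ≤ (⨆ N, G N z) + ENNReal.ofReal ε) →
        Tendsto x l (𝓝 z) := by
  set m : ENNReal := ⨆ N, ⨅ x ∈ C, G N x with hm
  have hle : ∀ x ∈ C, m ≤ ⨆ N, G N x := fun x hx =>
    iSup_mono fun N => iInf₂_le x hx
  have hmtop : m ≠ ⊤ := ne_top_of_le_ne_top hfin (hle x₀ hx₀)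
  have key : ∀ δ : ℝ, 0 < δ → ∃ N, ∃ ε : ℝ, 0 < ε ∧ ∀ a ∈ C, ∀ b ∈ C,
      G N a ≤ m + ENNReal.ofReal ε → G N b ≤ m + ENNReal.ofReal ε → ‖a - b‖ < δ := by
    intro δ hδ
    set ε : ℝ := c * δ ^ 2 / 4 with hε
    have hε0 : 0 < ε := by positivity
    obtain ⟨N, hN⟩ : ∃ N, m ≤ (⨅ x ∈ C, G N x) + ENNReal.ofReal ε := by
      rcases eq_or_ne m 0 with h0 | h0
      · exact ⟨0, by rw [h0]; exact zero_le⟩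
      · have h1 : m - ENNReal.ofReal ε < m :=
          ENNReal.sub_lt_self hmtop h0 (by simpa using hε0)
        obtain ⟨N, hN⟩ := lt_iSup_iff.1 (hm ▸ h1)
        exact ⟨N, tsub_le_iff_right.1 hN.le⟩
    refine ⟨N, ε, hε0, fun a ha b hb hGa hGb => ?_⟩
    have h1 : m + ENNReal.ofReal (c * ‖a - b‖ ^ 2) ≤
        m + (ENNReal.ofReal ε + ENNReal.ofReal ε) := by
      calc m + ENNReal.ofReal (c * ‖a - b‖ ^ 2)
          ≤ G N (midpoint ℝ a b) + ENNReal.ofReal ε + ENNReal.ofReal (c * ‖a - b‖ ^ 2) := by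
            gcongr
            exact hN.trans (by gcongr; exact iInf₂_le _ (hmid a ha b hb))
        _ = G N (midpoint ℝ a b) + ENNReal.ofReal (c * ‖a - b‖ ^ 2) + ENNReal.ofReal ε :=
            add_right_comm _ _ _
        _ ≤ (G N a + G N b) / 2 + ENNReal.ofReal ε := by gcongr; exact hconv N a ha b hb
        _ ≤ ((m + ENNReal.ofReal ε) + (m + ENNReal.ofReal ε)) / 2 + ENNReal.ofReal ε := by
            gcongr
        _ = m + (ENNReal.ofReal ε + ENNReal.ofReal ε) := by
            rw [ENNReal.add_div, ENNReal.add_halves, add_assoc]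
    have h2 := ENNReal.le_of_add_le_add_left hmtop h1
    rw [← ENNReal.ofReal_add hε0.le hε0.le, ENNReal.ofReal_le_ofReal_iff (by positivity)] at h2
    have h3 : ‖a - b‖ ^ 2 < δ ^ 2 := by
      have : c * ‖a - b‖ ^ 2 < c * δ ^ 2 := by
        have : 0 < c * δ ^ 2 := by positivity
        rw [hε] at h2
        linarith
      exact lt_of_mul_lt_mul_left this hc.le
    exact lt_of_pow_lt_pow_left₀ 2 hδ.le h3
  have hseq : ∀ N : ℕ, ∃ x ∈ C, G N x < m + ENNReal.ofReal (1 / ((N : ℝ) + 1)) := by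
    intro N
    have h1 : (⨅ x ∈ C, G N x) < m + ENNReal.ofReal (1 / ((N : ℝ) + 1)) :=
      (le_iSup (fun N => ⨅ x ∈ C, G N x) N).trans_lt
        (ENNReal.lt_add_right hmtop (by
          have : (0 : ℝ) < 1 / ((N : ℝ) + 1) := by positivity
          simpa using this))
    simpa only [iInf_lt_iff, exists_prop] using h1
  choose x hxC hxG using hseq
  have hxev : ∀ N, ∀ ε : ℝ, 0 < ε → ∀ᶠ k in atTop, G N (x k) ≤ m + ENNReal.ofReal ε := by
    intro N ε hε
    have h1 : ∀ᶠ k : ℕ in atTop, 1 / ((k : ℝ) + 1) < ε :=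
      tendsto_one_div_add_atTop_nhds_zero_nat.eventually (gt_mem_nhds hε)
    filter_upwards [h1, eventually_ge_atTop N] with k hk hNk
    exact (hmono hNk _).trans ((hxG k).le.trans (by gcongr))
  have hcauchy : CauchySeq x := by
    rw [Metric.cauchySeq_iff]
    intro δ hδ
    obtain ⟨N, ε, hε, h⟩ := key δ hδ
    obtain ⟨n, hn⟩ := eventually_atTop.1 (hxev N ε hε)
    refine ⟨n, fun i hi j hj => ?_⟩
    rw [dist_eq_norm]
    exact h _ (hxC i) _ (hxC j) (hn i hi) (hn j hj)
  obtain ⟨z, hz⟩ := cauchySeq_tendsto_of_complete hcauchy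
  have hzC : z ∈ C := hC.mem_of_tendsto hz (Eventually.of_forall hxC)
  have hGz : ∀ N, G N z ≤ m := by
    intro N
    refine ENNReal.le_of_forall_pos_le_add fun ε hε _ => ?_
    have hε' : (0 : ℝ) < ε := hε
    have h1 := ((hlsc N).isClosed_preimage (m + ENNReal.ofReal ε)).mem_of_tendsto hz
      (hxev N ε hε')
    simpa using h1
  have hsup : ⨆ N, G N z = m := le_antisymm (iSup_le hGz) (hle z hzC)
  refine ⟨z, hzC, fun x hx => hsup ▸ hle x hx, fun l y hyC hy => ?_⟩
  rw [hsup] at hy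
  rw [Metric.tendsto_nhds]
  intro δ hδ
  obtain ⟨N, ε, hε, h⟩ := key δ hδ
  filter_upwards [hyC, hy N ε hε] with t ht ht'
  rw [dist_eq_norm]
  exact h _ ht _ hzC ht' ((hGz N).trans le_self_add)

/-- Strong convexity of a coercive quadratic form, as the midpoint inequality that
`exists_minimizer_iSup` requires. -/
theorem ofReal_midpoint_add_le {X : Type*} [NormedAddCommGroup X] [NormedSpace ℝ X]
    {A : X →L[ℝ] StrongDual ℝ X} {c : ℝ} (hc : 0 ≤ c)
    (hA : ∀ x, c * ‖x‖ ^ 2 ≤ A x x) (a b : X) :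
    ENNReal.ofReal (A (midpoint ℝ a b) (midpoint ℝ a b)) +
        ENNReal.ofReal (c / 4 * ‖a - b‖ ^ 2) ≤
      (ENNReal.ofReal (A a a) + ENNReal.ofReal (A b b)) / 2 := by
  have hpos : ∀ x, 0 ≤ A x x := fun x => le_trans (by positivity) (hA x)
  have h2 : (2 : ENNReal) = ENNReal.ofReal 2 := by simp
  rw [← ENNReal.ofReal_add (by have := hpos (midpoint ℝ a b); positivity) (by positivity),
    ← ENNReal.ofReal_add (by have := hpos a; positivity) (by have := hpos b; positivity), h2,
    ← ENNReal.ofReal_div_of_pos two_pos]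
  apply ENNReal.ofReal_le_ofReal
  have h1 : midpoint ℝ a b = (1 / 2 : ℝ) • (a + b) := by
    rw [midpoint_eq_smul_add]; norm_num
  have h3 := hA (a - b)
  rw [h1]
  simp only [map_add, map_sub, map_smul, add_apply,
    sub_apply, smul_apply, smul_eq_mul] at h3 ⊢
  linarith

/-! ### Pointwise conditions and integral functionals on `Lp` -/

section Lp

variable {Ω : Type*} [MeasurableSpace Ω] {μ : Measure Ω} {E : Type*} [NormedAddCommGroup E]
  {p : ENNReal} [Fact (1 ≤ p)]

theorem Lp_exists_subseq_tendsto_ae {f : ℕ → Lp E p μ} {g : Lp E p μ}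
    (h : Tendsto f atTop (𝓝 g)) :
    ∃ φ : ℕ → ℕ, StrictMono φ ∧ ∀ᵐ x ∂μ, Tendsto (fun k => f (φ k) x) atTop (𝓝 (g x)) :=
  (tendstoInMeasure_of_tendsto_Lp h).exists_seq_tendsto_ae

theorem isClosed_setOf_ae {P : Ω → E → Prop} (hP : ∀ x, IsClosed {y | P x y}) :
    IsClosed {f : Lp E p μ | ∀ᵐ x ∂μ, P x (f x)} := by
  refine IsSeqClosed.isClosed fun f g hf hg => ?_
  obtain ⟨φ, -, hφ⟩ := Lp_exists_subseq_tendsto_ae hg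
  have h : ∀ᵐ x ∂μ, ∀ k, P x (f k x) := ae_all_iff.2 hf
  change ∀ᵐ x ∂μ, P x (g x)
  filter_upwards [hφ, h] with x hx hx'
  exact (hP x).mem_of_tendsto hx (Eventually.of_forall fun k => hx' (φ k))

/-- Fatou's lemma along an almost everywhere convergent subsequence. -/
theorem lowerSemicontinuous_lintegral_comp {F : Ω → E → ENNReal} (hF : ∀ x, Continuous (F x))
    (hmeas : ∀ f : Lp E p μ, AEMeasurable (fun x => F x (f x)) μ) :
    LowerSemicontinuous fun f : Lp E p μ => ∫⁻ x, F x (f x) ∂μ := by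
  rw [lowerSemicontinuous_iff_isClosed_preimage]
  refine fun M => IsSeqClosed.isClosed fun f g hf hg => ?_
  obtain ⟨φ, -, hφ⟩ := Lp_exists_subseq_tendsto_ae hg
  change ∫⁻ x, F x (g x) ∂μ ≤ M
  calc ∫⁻ x, F x (g x) ∂μ = ∫⁻ x, liminf (fun k => F x (f (φ k) x)) atTop ∂μ := by
        refine lintegral_congr_ae ?_
        filter_upwards [hφ] with x hx
        exact (((hF x).tendsto _).comp hx).liminf_eq.symm
    _ ≤ liminf (fun k => ∫⁻ x, F x (f (φ k) x) ∂μ) atTop :=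
        lintegral_liminf_le' fun k => hmeas _
    _ ≤ M := by
        exact liminf_le_of_frequently_le'
          (Eventually.frequently (Eventually.of_forall fun k => hf (φ k)))

end Lp

/-! ### Recovery sequences for the unit ball constraint -/

theorem exists_generalizedInverse {E F : Type*} [AddCommGroup E] [Module ℝ E] [AddCommGroup F]
    [Module ℝ F] (D : E →ₗ[ℝ] F) : ∃ P : F →ₗ[ℝ] E, ∀ x, D (P (D x)) = D x := by
  obtain ⟨g, hg⟩ := D.rangeRestrict.exists_rightInverse_of_surjective D.range_rangeRestrict
  obtain ⟨P, hP⟩ := LinearMap.exists_extend g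
  refine ⟨P, fun x => ?_⟩
  have h1 : P (D x) = g (D.rangeRestrict x) := LinearMap.congr_fun hP (D.rangeRestrict x)
  have h2 := LinearMap.congr_fun hg (D.rangeRestrict x)
  rw [h1]
  exact congrArg Subtype.val h2

section Pointwise

variable {F : Type*} [NormedAddCommGroup F]

/-- The factor by which radial projection onto the closed unit ball scales `v`. -/
def radialFactor (v : F) : ℝ := (max 1 ‖v‖)⁻¹

theorem continuous_radialFactor : Continuous (radialFactor : F → ℝ) :=
  (continuous_const.max continuous_norm).inv₀ fun v => (one_pos.trans_le (le_max_left 1 ‖v‖)).ne'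

theorem radialFactor_nonneg (v : F) : 0 ≤ radialFactor v :=
  inv_nonneg.2 (zero_le_one.trans (le_max_left _ _))

theorem radialFactor_le_one (v : F) : radialFactor v ≤ 1 :=
  inv_le_one_of_one_le₀ (le_max_left _ _)

theorem radialFactor_mul_norm_le (v : F) : radialFactor v * ‖v‖ ≤ 1 := by
  unfold radialFactor
  rw [inv_mul_le_one₀ (one_pos.trans_le (le_max_left 1 ‖v‖))]
  exact le_max_right _ _

theorem one_sub_radialFactor_mul_norm (v : F) :
    (1 - radialFactor v) * ‖v‖ = max 0 (‖v‖ - 1) := by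
  unfold radialFactor
  rcases le_total ‖v‖ 1 with h | h
  · rw [max_eq_left h, max_eq_left (by linarith)]; simp
  · rw [max_eq_right h, max_eq_right (by linarith)]
    have : ‖v‖ ≠ 0 := by linarith
    field_simp

theorem two_mul_one_sub_radialFactor_le (v : F) :
    2 * (1 - radialFactor v) ≤ max 0 (‖v‖ ^ 2 - 1) := by
  unfold radialFactor
  rcases le_total ‖v‖ 1 with h | h
  · rw [max_eq_left h]; simp
  · rw [max_eq_right h]
    refine le_max_of_le_right ?_
    have h0 : 0 < ‖v‖ := by linarith
    have h1 : 2 - ‖v‖ ≤ ‖v‖⁻¹ := by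
      rw [inv_eq_one_div, le_div_iff₀ h0]
      nlinarith [sq_nonneg (‖v‖ - 1)]
    nlinarith [sq_nonneg (‖v‖ - 1)]

variable [InnerProductSpace ℝ F]

theorem norm_add_smul_sq (s d : F) (t : ℝ) :
    ‖s + t • d‖ ^ 2 = ‖s‖ ^ 2 + 2 * t * inner ℝ s d + t ^ 2 * ‖d‖ ^ 2 := by
  rw [norm_add_sq_real, inner_smul_right, norm_smul, mul_pow, Real.norm_eq_abs, sq_abs]
  ring

/-- Moving from a point of the unit ball in a direction that does not point out of it leaves the
ball at most to second order. -/
theorem tendsto_excess_div {s d : F} (hs : ‖s‖ ≤ 1) (hsd : ‖s‖ = 1 → inner ℝ s d ≤ 0) :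
    Tendsto (fun t : ℝ => max 0 (‖s + t • d‖ - 1) / t) (𝓝[>] 0) (𝓝 0) := by
  rcases hs.lt_or_eq with h | h
  · have hc : Tendsto (fun t : ℝ => ‖s + t • d‖) (𝓝[>] 0) (𝓝 ‖s + (0 : ℝ) • d‖) :=
      (Continuous.tendsto (by fun_prop) 0).mono_left nhdsWithin_le_nhds
    rw [zero_smul, add_zero] at hc
    refine tendsto_const_nhds.congr' ?_
    filter_upwards [hc.eventually (gt_mem_nhds h)] with t ht
    rw [max_eq_left (by linarith), zero_div]
  · have hlim : Tendsto (fun t : ℝ => t * (‖d‖ ^ 2 / 2)) (𝓝[>] 0) (𝓝 (0 * (‖d‖ ^ 2 / 2))) :=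
      (Continuous.tendsto (by fun_prop) 0).mono_left nhdsWithin_le_nhds
    rw [zero_mul] at hlim
    refine tendsto_of_tendsto_of_tendsto_of_le_of_le' tendsto_const_nhds hlim ?_ ?_
    · filter_upwards [self_mem_nhdsWithin] with t ht
      exact div_nonneg (le_max_left _ _) (le_of_lt ht)
    · filter_upwards [self_mem_nhdsWithin] with t ht
      have ht : 0 < t := ht
      rw [div_le_iff₀ ht]
      refine max_le (by positivity) ?_
      have h1 := norm_add_smul_sq s d t
      rw [h] at h1
      have h2 : 2 * t * inner ℝ s d ≤ 0 := mul_nonpos_of_nonneg_of_nonpos (by positivity) (hsd h)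
      nlinarith [sq_nonneg (‖s + t • d‖ - 1)]

theorem excess_le {s d : F} (hs : ‖s‖ ≤ 1) (t : ℝ) : max 0 (‖s + t • d‖ - 1) ≤ |t| * ‖d‖ := by
  refine max_le (by positivity) ?_
  have := norm_add_le s (t • d)
  rw [norm_smul, Real.norm_eq_abs] at this
  linarith

end Pointwise

section Recovery

variable {Ω : Type*} [MeasurableSpace Ω] {μ : Measure Ω} {m n : ℕ}

/-- The directions that pointwise belong to the tangent cone of `{|D σ| ≤ 1}` in `S`. -/
def tangentDirections (D : EuclideanSpace ℝ (Fin m) →ₗ[ℝ] EuclideanSpace ℝ (Fin n))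
    (S : StressSpace μ m) : Set (StressSpace μ m) :=
  {z | ∀ᵐ x ∂μ, ‖D (S x)‖ = 1 → inner ℝ (D (S x)) (D (z x)) ≤ 0}

/-- Every pointwise tangent direction `z` is a norm limit of directions `w t` with
`S + t • w t` admissible. Where `D z` is tangential to the sphere, `D (w t)` points into the ball at
most by the curvature term `t |D z|² / 2`. The stress `S + t • w t` results from projecting
`D (S + t z)` radially onto the unit ball and lifting the correction by a generalized inverse
of `D`. -/
theorem exists_recovery {D : EuclideanSpace ℝ (Fin m) →ₗ[ℝ] EuclideanSpace ℝ (Fin n)}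
    {S z : StressSpace μ m} (hS : S ∈ admissibleSet μ D) (hz : z ∈ tangentDirections D S) :
    ∃ w : ℝ → StressSpace μ m, Tendsto w (𝓝[>] 0) (𝓝 z) ∧ ∀ t, 0 < t →
      S + t • w t ∈ admissibleSet μ D ∧ ∀ᵐ x ∂μ, ‖D (S x)‖ = 1 →
        inner ℝ (D (S x)) (D (z x)) = 0 →
          -2 * inner ℝ (D (S x)) (D (w t x)) ≤ t * ‖D (z x)‖ ^ 2 := by
  obtain ⟨P, hP⟩ := exists_generalizedInverse D
  have hDc : Continuous D := D.continuous_of_finiteDimensional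
  have hPc : Continuous P := P.continuous_of_finiteDimensional
  obtain ⟨c, hc0, hc⟩ : ∃ c : ℝ, 0 ≤ c ∧ ∀ v, ‖P v‖ ≤ c * ‖v‖ :=
    ⟨_, norm_nonneg _, P.toContinuousLinearMap.le_opNorm⟩
  let v : ℝ → Ω → EuclideanSpace ℝ (Fin n) := fun t x => D (S x) + t • D (z x)
  have hDP : ∀ t x, D (P (v t x)) = v t x := fun t x => by
    have : v t x = D (S x + t • z x) := by simp [v]
    rw [this, hP]
  let e : ℝ → Ω → EuclideanSpace ℝ (Fin m) := fun t x =>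
    ((1 - radialFactor (v t x)) / t) • P (v t x)
  have hDS : AEStronglyMeasurable (fun x => D (S x)) μ :=
    hDc.comp_aestronglyMeasurable (Lp.aestronglyMeasurable S)
  have hDz : AEStronglyMeasurable (fun x => D (z x)) μ :=
    hDc.comp_aestronglyMeasurable (Lp.aestronglyMeasurable z)
  have hvm : ∀ t, AEStronglyMeasurable (v t) μ := fun t => hDS.add (hDz.const_smul t)
  have hem : ∀ t, AEStronglyMeasurable (e t) μ := fun t =>
    Continuous.comp_aestronglyMeasurable (g := fun y => ((1 - radialFactor y) / t) • P y)
      (((continuous_const.sub continuous_radialFactor).div_const t).smul hPc) (hvm t)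
  have henorm : ∀ t x, ‖e t x‖ ≤ c * (max 0 (‖v t x‖ - 1) / |t|) := by
    intro t x
    rw [norm_smul, Real.norm_eq_abs, abs_div,
      abs_of_nonneg (sub_nonneg.2 (radialFactor_le_one (v t x))),
      ← one_sub_radialFactor_mul_norm]
    calc (1 - radialFactor (v t x)) / |t| * ‖P (v t x)‖
        ≤ (1 - radialFactor (v t x)) / |t| * (c * ‖v t x‖) := by
          gcongr
          · exact div_nonneg (sub_nonneg.2 (radialFactor_le_one _)) (abs_nonneg _)
          · exact hc _
      _ = c * ((1 - radialFactor (v t x)) * ‖v t x‖ / |t|) := by ring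
  have hebd : ∀ t, ∀ᵐ x ∂μ, ‖e t x‖ ≤ c * ‖D (z x)‖ := by
    intro t
    filter_upwards [hS] with x hx
    refine (henorm t x).trans ?_
    gcongr
    exact div_le_of_le_mul₀ (abs_nonneg _) (norm_nonneg _)
      ((excess_le hx t).trans (mul_comm _ _).le)
  have hDzL : MemLp (fun x => D (z x)) 2 μ :=
    D.toContinuousLinearMap.comp_memLp' (Lp.memLp z)
  have heL : ∀ t, MemLp (e t) 2 μ := fun t => hDzL.of_le_mul (hem t) (hebd t)
  refine ⟨fun t => z - (heL t).toLp (e t), ?_, fun t ht => ⟨?_, ?_⟩⟩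
  · have hnorm : ∀ t, ‖(heL t).toLp (e t)‖ ^ 2 = ∫ x, ‖e t x‖ ^ 2 ∂μ := by
      intro t
      rw [← real_inner_self_eq_norm_sq, L2.inner_def]
      refine integral_congr_ae ?_
      filter_upwards [(heL t).coeFn_toLp] with x hx
      rw [hx, real_inner_self_eq_norm_sq]
    have hlim : Tendsto (fun t => ∫ x, ‖e t x‖ ^ 2 ∂μ) (𝓝[>] 0) (𝓝 (∫ _, (0 : ℝ) ∂μ)) := by
      refine tendsto_integral_filter_of_dominated_convergence
        (fun x => (c * ‖D (z x)‖) ^ 2) ?_ ?_ ?_ ?_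
      · exact Eventually.of_forall fun t => (hem t).norm.pow 2
      · refine Eventually.of_forall fun t => ?_
        filter_upwards [hebd t] with x hx
        rw [Real.norm_eq_abs, abs_of_nonneg (by positivity)]
        gcongr
      · simp_rw [mul_pow]
        exact ((memLp_two_iff_integrable_sq_norm hDz).1 hDzL).const_mul _
      · filter_upwards [hS, hz] with x hx hx'
        have h1 := (tendsto_excess_div hx hx').const_mul c
        rw [mul_zero] at h1
        have h2 : Tendsto (fun t => ‖e t x‖) (𝓝[>] 0) (𝓝 0) := by
          refine squeeze_zero' (Eventually.of_forall fun t => norm_nonneg _) ?_ h1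
          filter_upwards [self_mem_nhdsWithin] with t ht
          have := henorm t x
          rwa [abs_of_pos ht] at this
        simpa using h2.pow 2
    rw [integral_zero] at hlim
    have h3 : Tendsto (fun t => (heL t).toLp (e t)) (𝓝[>] 0) (𝓝 0) := by
      rw [tendsto_zero_iff_norm_tendsto_zero]
      simp_rw [← hnorm] at hlim
      have := hlim.sqrt
      simpa [Real.sqrt_sq (norm_nonneg _)] using this
    simpa using (tendsto_const_nhds (x := z)).sub h3
  · change ∀ᵐ x ∂μ, _
    filter_upwards [Lp.coeFn_add S (t • (z - (heL t).toLp (e t))),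
      Lp.coeFn_smul t (z - (heL t).toLp (e t)), Lp.coeFn_sub z ((heL t).toLp (e t)),
      (heL t).coeFn_toLp] with x h1 h2 h3 h4
    have h5 : D ((S + t • (z - (heL t).toLp (e t))) x) = radialFactor (v t x) • v t x := by
      rw [h1, Pi.add_apply, h2, Pi.smul_apply, h3, Pi.sub_apply, h4]
      simp only [map_add, map_smul, map_sub, e, hDP, smul_sub, smul_smul]
      rw [mul_div_cancel₀ _ ht.ne', ← add_sub_assoc]
      change v t x - _ = _
      rw [sub_smul, one_smul, sub_sub_cancel]
    rw [h5, norm_smul, Real.norm_eq_abs, abs_of_nonneg (radialFactor_nonneg _)]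
    exact radialFactor_mul_norm_le _
  · filter_upwards [Lp.coeFn_sub z ((heL t).toLp (e t)), (heL t).coeFn_toLp] with x h3 h4 h5 h6
    rw [h3, Pi.sub_apply, h4]
    simp only [map_sub, e, map_smul, hDP, inner_sub_right, h6, inner_smul_right]
    have h7 : inner ℝ (D (S x)) (v t x) = (1 : ℝ) := by
      simp [v, inner_add_right, inner_smul_right, h6, h5]
    have h8 : ‖v t x‖ ^ 2 - 1 = t ^ 2 * ‖D (z x)‖ ^ 2 := by
      simp only [v]
      rw [norm_add_smul_sq, h5, h6]; ring
    have h9 := two_mul_one_sub_radialFactor_le (v t x)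
    rw [h8, max_eq_right (by positivity)] at h9
    rw [h7]
    have h10 : -2 * (0 - (1 - radialFactor (v t x)) / t * 1) =
        2 * (1 - radialFactor (v t x)) / t := by
      ring
    rw [h10, div_le_iff₀ ht]
    linarith

end Recovery

/-! ### Multipliers for normal directions of the admissible set -/

section Multiplier

variable {Ω : Type*} [MeasurableSpace Ω] {μ : Measure Ω} {m n : ℕ}
  {D : EuclideanSpace ℝ (Fin m) →ₗ[ℝ] EuclideanSpace ℝ (Fin n)} {S : StressSpace μ m}
  {Ξ : StrongDual ℝ (StressSpace μ m)} {lam : Lp ℝ 2 μ}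

theorem memLp_comp_linearMap (D : EuclideanSpace ℝ (Fin m) →ₗ[ℝ] EuclideanSpace ℝ (Fin n))
    (T : StressSpace μ m) : MemLp (fun x => D (T x)) 2 μ :=
  D.toContinuousLinearMap.comp_memLp' (Lp.memLp T)

theorem map_add_ae (D : EuclideanSpace ℝ (Fin m) →ₗ[ℝ] EuclideanSpace ℝ (Fin n))
    (T₁ T₂ : StressSpace μ m) : ∀ᵐ x ∂μ, D ((T₁ + T₂) x) = D (T₁ x) + D (T₂ x) := by
  filter_upwards [Lp.coeFn_add T₁ T₂] with x hx
  rw [hx, Pi.add_apply, map_add]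

theorem map_sub_ae (D : EuclideanSpace ℝ (Fin m) →ₗ[ℝ] EuclideanSpace ℝ (Fin n))
    (T₁ T₂ : StressSpace μ m) : ∀ᵐ x ∂μ, D ((T₁ - T₂) x) = D (T₁ x) - D (T₂ x) := by
  filter_upwards [Lp.coeFn_sub T₁ T₂] with x hx
  rw [hx, Pi.sub_apply, map_sub]

theorem map_smul_ae (D : EuclideanSpace ℝ (Fin m) →ₗ[ℝ] EuclideanSpace ℝ (Fin n))
    (r : ℝ) (T : StressSpace μ m) : ∀ᵐ x ∂μ, D ((r • T) x) = r • D (T x) := by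
  filter_upwards [Lp.coeFn_smul r T] with x hx
  rw [hx, Pi.smul_apply, map_smul]

theorem memLp_inner_of_admissible (hS : S ∈ admissibleSet μ D) (T : StressSpace μ m) :
    MemLp (fun x => (inner ℝ (D (S x)) (D (T x)) : ℝ)) 2 μ := by
  have hT := memLp_comp_linearMap D T
  refine hT.of_le ((memLp_comp_linearMap D S).1.inner hT.1) ?_
  filter_upwards [hS] with x hx
  calc ‖(inner ℝ (D (S x)) (D (T x)) : ℝ)‖ ≤ ‖D (S x)‖ * ‖D (T x)‖ := norm_inner_le_norm _ _
    _ ≤ 1 * ‖D (T x)‖ := by gcongr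
    _ = _ := one_mul _

theorem integrable_mul_inner (hS : S ∈ admissibleSet μ D) (lam : Lp ℝ 2 μ)
    (T : StressSpace μ m) : Integrable (fun x => lam x * inner ℝ (D (S x)) (D (T x))) μ :=
  (Lp.memLp lam).integrable_mul (memLp_inner_of_admissible hS T)

theorem isClosed_tangentDirections (D : EuclideanSpace ℝ (Fin m) →ₗ[ℝ] EuclideanSpace ℝ (Fin n))
    (S : StressSpace μ m) : IsClosed (tangentDirections D S) := by
  have hDc : Continuous D := D.continuous_of_finiteDimensional
  refine isClosed_setOf_ae (P := fun x y => ‖D (S x)‖ = 1 → inner ℝ (D (S x)) (D y) ≤ 0) fun x => ?_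
  by_cases h : ‖D (S x)‖ = 1
  · simp only [h, forall_const]
    exact isClosed_le (continuous_const.inner hDc) continuous_const
  · simp [h]

theorem smul_add_smul_mem_tangentDirections {a b : StressSpace μ m}
    (ha : a ∈ tangentDirections D S) (hb : b ∈ tangentDirections D S) {α β : ℝ} (hα : 0 ≤ α)
    (hβ : 0 ≤ β) : α • a + β • b ∈ tangentDirections D S := by
  change ∀ᵐ x ∂μ, _
  filter_upwards [ha, hb, map_add_ae D (α • a) (β • b), map_smul_ae D α a, map_smul_ae D β b]
    with x h1 h2 h3 h4 h5 h6
  rw [h3, h4, h5, inner_add_right, inner_smul_right, inner_smul_right]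
  nlinarith [mul_nonneg hα (neg_nonneg.2 (h1 h6)), mul_nonneg hβ (neg_nonneg.2 (h2 h6))]

theorem deviatorKernel_subset_tangentDirections :
    deviatorKernel μ D ⊆ tangentDirections D S := by
  intro h hh
  change ∀ᵐ x ∂μ, _
  filter_upwards [hh] with x hx _
  rw [norm_eq_zero.1 hx, inner_zero_right]

theorem nonpos_of_mem_tangentDirections (hS : S ∈ admissibleSet μ D)
    (hΞ : ∀ T ∈ admissibleSet μ D, Ξ (T - S) ≤ 0) {z : StressSpace μ m}
    (hz : z ∈ tangentDirections D S) : Ξ z ≤ 0 := by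
  obtain ⟨w, hw, hw'⟩ := exists_recovery hS hz
  refine le_of_tendsto ((Ξ.continuous.tendsto z).comp hw) ?_
  filter_upwards [self_mem_nhdsWithin] with t ht
  have h1 := hΞ _ (hw' t ht).1
  rw [add_sub_cancel_left, map_smul, smul_eq_mul] at h1
  exact nonpos_of_mul_nonpos_right h1 ht

/-- `Ξ = lam D⋆ D S` with a multiplier `lam ≥ 0` that vanishes off `{|D S| = 1}`. -/
def IsNormalMultiplier (D : EuclideanSpace ℝ (Fin m) →ₗ[ℝ] EuclideanSpace ℝ (Fin n))
    (S : StressSpace μ m) (Ξ : StrongDual ℝ (StressSpace μ m)) (lam : Lp ℝ 2 μ) : Prop :=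
  (∀ᵐ x ∂μ, 0 ≤ lam x) ∧ (∀ᵐ x ∂μ, ‖D (S x)‖ ≠ 1 → lam x = 0) ∧
    ∀ T : StressSpace μ m, Ξ T = ∫ x, lam x * inner ℝ (D (S x)) (D (T x)) ∂μ

/-- Functionals in the normal cone of the admissible set possess a square integrable multiplier.
With a generalized inverse `P` of `D` and the Riesz representative `ξ` of `Ξ`, the multiplier is
`⟨ξ, P D S⟩` on `{|D S| = 1}`. Indeed, after subtraction of `⟨D S, D T⟩ P D S` on this set, any `T`
is tangential, and so is its negative, so that `Ξ` vanishes there. -/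
theorem exists_isNormalMultiplier (hS : S ∈ admissibleSet μ D)
    (hΞ : ∀ T ∈ admissibleSet μ D, Ξ (T - S) ≤ 0) : ∃ lam, IsNormalMultiplier D S Ξ lam := by
  obtain ⟨P, hP⟩ := exists_generalizedInverse D
  have hDc : Continuous D := D.continuous_of_finiteDimensional
  have hPc : Continuous P := P.continuous_of_finiteDimensional
  obtain ⟨c, hc0, hc⟩ : ∃ c : ℝ, 0 ≤ c ∧ ∀ v, ‖P v‖ ≤ c * ‖v‖ :=
    ⟨_, norm_nonneg _, P.toContinuousLinearMap.le_opNorm⟩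
  let ξ : StressSpace μ m := (InnerProductSpace.toDual ℝ (StressSpace μ m)).symm Ξ
  have hξ : ∀ T, Ξ T = ∫ x, inner ℝ (ξ x) (T x) ∂μ := fun T => by
    rw [← L2.inner_def, InnerProductSpace.toDual_symm_apply]
  have hDS : StronglyMeasurable (fun x => D (S x)) :=
    hDc.comp_stronglyMeasurable (Lp.stronglyMeasurable S)
  have hPS : StronglyMeasurable (fun x => P (D (S x))) := hPc.comp_stronglyMeasurable hDS
  have hPSbd : ∀ᵐ x ∂μ, ‖P (D (S x))‖ ≤ c := by
    filter_upwards [hS] with x hx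
    exact (hc _).trans (mul_le_of_le_one_right hc0 hx)
  let s : Set Ω := {x | ‖D (S x)‖ = 1}
  have hs : MeasurableSet s := measurableSet_eq_fun hDS.norm.measurable measurable_const
  let h : Ω → ℝ := s.indicator fun x => inner ℝ (ξ x) (P (D (S x)))
  have hm : StronglyMeasurable h := ((Lp.stronglyMeasurable ξ).inner hPS).indicator hs
  have hL : MemLp h 2 μ := by
    refine (Lp.memLp ξ).of_le_mul (c := c) hm.aestronglyMeasurable ?_
    filter_upwards [hPSbd] with x hx
    refine (norm_indicator_le_norm_self _ _).trans ((norm_inner_le_norm _ _).trans ?_)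
    rw [mul_comm]
    gcongr
  have hlam := hL.coeFn_toLp
  have hrep : ∀ T, Ξ T = ∫ x, (hL.toLp h) x * inner ℝ (D (S x)) (D (T x)) ∂μ := by
    intro T
    let f : Ω → EuclideanSpace ℝ (Fin m) :=
      s.indicator fun x => (inner ℝ (D (S x)) (D (T x)) : ℝ) • P (D (S x))
    have hfm : AEStronglyMeasurable f μ :=
      ((memLp_inner_of_admissible hS T).1.smul hPS.aestronglyMeasurable).indicator hs
    have hfL : MemLp f 2 μ := by
      refine (memLp_inner_of_admissible hS T).of_le_mul (c := c) hfm ?_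
      filter_upwards [hPSbd] with x hx
      refine (norm_indicator_le_norm_self _ _).trans ?_
      rw [norm_smul, mul_comm]
      gcongr
    have hzero : ∀ᵐ x ∂μ, ‖D (S x)‖ = 1 →
        inner ℝ (D (S x)) (D ((T - hfL.toLp f) x)) = (0 : ℝ) := by
      filter_upwards [map_sub_ae D T (hfL.toLp f), hfL.coeFn_toLp] with x h1 h2 h3
      have h4 : f x = (inner ℝ (D (S x)) (D (T x)) : ℝ) • P (D (S x)) :=
        Set.indicator_of_mem (show x ∈ s from h3) _
      rw [h1, h2, h4, map_smul, hP, inner_sub_right, inner_smul_right,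
        real_inner_self_eq_norm_sq, h3]
      ring
    have hle := nonpos_of_mem_tangentDirections hS hΞ (z := T - hfL.toLp f) (by
      change ∀ᵐ x ∂μ, _
      filter_upwards [hzero] with x hx h1 using (hx h1).le)
    have hge := nonpos_of_mem_tangentDirections hS hΞ (z := (-1 : ℝ) • (T - hfL.toLp f)) (by
      change ∀ᵐ x ∂μ, _
      filter_upwards [hzero, map_smul_ae D (-1) (T - hfL.toLp f)] with x hx h2 h1
      rw [h2, inner_smul_right, hx h1, mul_zero])
    rw [map_smul, smul_eq_mul] at hge
    rw [map_sub] at hle hge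
    have heq : Ξ T = Ξ (hfL.toLp f) := by linarith
    rw [heq, hξ]
    refine integral_congr_ae ?_
    filter_upwards [hfL.coeFn_toLp, hlam] with x h1 h2
    rw [h1, h2]
    by_cases hx : x ∈ s
    · simp only [f, h, Set.indicator_of_mem hx, inner_smul_right]
      ring
    · simp [f, h, Set.indicator_of_notMem hx]
  refine ⟨hL.toLp h, ?_, ?_, hrep⟩
  · -- test with `-P D S` on the set where the multiplier is negative
    let E : Set Ω := {x | h x < 0}
    have hE : MeasurableSet E := measurableSet_lt hm.measurable measurable_const
    have hEs : E ⊆ s := by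
      intro x hx
      by_contra hxs
      have h1 : h x = 0 := Set.indicator_of_notMem hxs _
      have h2 : h x < 0 := hx
      linarith
    let f : Ω → EuclideanSpace ℝ (Fin m) := E.indicator fun x => -P (D (S x))
    have hfL : MemLp f 2 μ :=
      (P.toContinuousLinearMap.comp_memLp' (memLp_comp_linearMap D S)).neg.indicator hE
    have hval : ∀ᵐ x ∂μ,
        inner ℝ (D (S x)) (D ((hfL.toLp f) x)) = E.indicator (fun _ => (-1 : ℝ)) x := by
      filter_upwards [hfL.coeFn_toLp] with x h1
      rw [h1]
      by_cases hx : x ∈ E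
      · have h3 : ‖D (S x)‖ = 1 := hEs hx
        simp only [f, Set.indicator_of_mem hx, map_neg, hP, inner_neg_right,
          real_inner_self_eq_norm_sq, h3]
        norm_num
      · simp [f, Set.indicator_of_notMem hx]
    have hle := nonpos_of_mem_tangentDirections hS hΞ (z := hfL.toLp f) (by
      change ∀ᵐ x ∂μ, _
      filter_upwards [hval] with x hx _
      rw [hx]
      exact Set.indicator_nonpos (fun _ _ => by norm_num) x)
    rw [hrep] at hle
    have hnn : 0 ≤ᵐ[μ] fun x => (hL.toLp h) x * inner ℝ (D (S x)) (D ((hfL.toLp f) x)) := by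
      filter_upwards [hval, hlam] with x h1 h2
      rw [h1, h2]
      by_cases hx : x ∈ E
      · have h3 : h x < 0 := hx
        simp only [Set.indicator_of_mem hx, Pi.zero_apply]
        linarith
      · simp [Set.indicator_of_notMem hx]
    have hz := (integral_eq_zero_iff_of_nonneg_ae hnn (integrable_mul_inner hS _ _)).1
      (le_antisymm hle (integral_nonneg_of_ae hnn))
    filter_upwards [hz, hval, hlam] with x h1 h2 h3
    rw [h3]
    by_contra hx
    have hx : x ∈ E := not_le.1 hx
    have h4 : h x < 0 := hx
    rw [h2, h3, Set.indicator_of_mem hx, Pi.zero_apply] at h1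
    linarith
  · filter_upwards [hlam] with x h1 h2
    rw [h1]
    exact Set.indicator_of_notMem (show x ∉ s from h2) _

theorem IsNormalMultiplier.unique (hS : S ∈ admissibleSet μ D) {lam₁ lam₂ : Lp ℝ 2 μ}
    (h₁ : IsNormalMultiplier D S Ξ lam₁) (h₂ : IsNormalMultiplier D S Ξ lam₂) : lam₁ = lam₂ := by
  obtain ⟨P, hP⟩ := exists_generalizedInverse D
  have hDc : Continuous D := D.continuous_of_finiteDimensional
  have hPc : Continuous P := P.continuous_of_finiteDimensional
  obtain ⟨c, hc0, hc⟩ : ∃ c : ℝ, 0 ≤ c ∧ ∀ v, ‖P v‖ ≤ c * ‖v‖ :=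
    ⟨_, norm_nonneg _, P.toContinuousLinearMap.le_opNorm⟩
  -- test with `(lam₁ - lam₂) P D S`
  let f : Ω → EuclideanSpace ℝ (Fin m) := fun x => (lam₁ - lam₂) x • P (D (S x))
  have hfL : MemLp f 2 μ := by
    have hfm : AEStronglyMeasurable f μ := AEStronglyMeasurable.smul
      (Lp.aestronglyMeasurable (lam₁ - lam₂))
      (hPc.comp_aestronglyMeasurable (hDc.comp_aestronglyMeasurable (Lp.aestronglyMeasurable S)))
    refine (Lp.memLp (lam₁ - lam₂)).of_le_mul (c := c) hfm ?_
    filter_upwards [hS] with x hx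
    rw [norm_smul, mul_comm]
    gcongr
    exact (hc _).trans (mul_le_of_le_one_right hc0 hx)
  have h1 := h₁.2.2 (hfL.toLp f)
  rw [h₂.2.2, ← sub_eq_zero, ← integral_sub (integrable_mul_inner hS _ _)
    (integrable_mul_inner hS _ _)] at h1
  have h3 : (fun x => lam₂ x * inner ℝ (D (S x)) (D ((hfL.toLp f) x)) -
      lam₁ x * inner ℝ (D (S x)) (D ((hfL.toLp f) x))) =ᵐ[μ]
      fun x => -((lam₁ - lam₂) x) ^ 2 := by
    filter_upwards [hfL.coeFn_toLp, Lp.coeFn_sub lam₁ lam₂, h₁.2.1, h₂.2.1] with x e1 e2 e3 e4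
    rw [e1]
    simp only [f, map_smul, hP, inner_smul_right, real_inner_self_eq_norm_sq]
    by_cases hx : ‖D (S x)‖ = 1
    · rw [hx, e2, Pi.sub_apply]; ring
    · rw [e2, Pi.sub_apply, e3 hx, e4 hx]; simp
  rw [integral_congr_ae h3, integral_neg, neg_eq_zero] at h1
  have h4 := (integral_eq_zero_iff_of_nonneg (fun x => sq_nonneg _)
    (Lp.memLp (lam₁ - lam₂)).integrable_sq).1 h1
  refine Lp.ext ?_
  filter_upwards [h4, Lp.coeFn_sub lam₁ lam₂] with x e1 e2
  have e3 : (lam₁ - lam₂) x = 0 := by simpa using e1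
  rw [e2, Pi.sub_apply] at e3
  linarith

theorem isPlasticMultiplier_iff {V : Type*} [NormedAddCommGroup V] [InnerProductSpace ℝ V]
    {A : StressSpace μ m →L[ℝ] StrongDual ℝ (StressSpace μ m)}
    {B : StressSpace μ m →L[ℝ] StrongDual ℝ V} {u : V} :
    IsPlasticMultiplier A B D S u lam ↔ IsNormalMultiplier D S (-(A S + B.flip u)) lam := by
  have h : ∀ T : StressSpace μ m, ∫ x, inner ℝ (lam x • LinearMap.adjoint D (D (S x))) (T x) ∂μ =
      ∫ x, lam x * inner ℝ (D (S x)) (D (T x)) ∂μ := fun T => by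
    simp only [real_inner_smul_left, LinearMap.adjoint_inner_left]
  refine and_congr_right fun _ => and_congr_right fun _ => forall_congr' fun T => ?_
  rw [h, neg_apply, neg_eq_iff_add_eq_zero]

end Multiplier

/-! ### The curvature functional and the reduced critical cone -/

section Curvature

variable {Ω : Type*} [MeasurableSpace Ω] {μ : Measure Ω} {m n : ℕ}
  {D : EuclideanSpace ℝ (Fin m) →ₗ[ℝ] EuclideanSpace ℝ (Fin n)} {S : StressSpace μ m}
  {Ξ : StrongDual ℝ (StressSpace μ m)} {lam : Lp ℝ 2 μ}

/-- The curvature functional `∫ lam |D σ|² dμ`, with value `∞` allowed since `lam` is merely square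
integrable. -/
def curvature (D : EuclideanSpace ℝ (Fin m) →ₗ[ℝ] EuclideanSpace ℝ (Fin n)) (lam : Lp ℝ 2 μ)
    (σ : StressSpace μ m) : ENNReal :=
  ∫⁻ x, ENNReal.ofReal (lam x * ‖D (σ x)‖ ^ 2) ∂μ

/-- The explicit form of the reduced critical cone: pointwise tangent directions that are
annihilated by the normal direction `Ξ` and have finite curvature. -/
def curvatureCone (D : EuclideanSpace ℝ (Fin m) →ₗ[ℝ] EuclideanSpace ℝ (Fin n))
    (S : StressSpace μ m) (Ξ : StrongDual ℝ (StressSpace μ m)) (lam : Lp ℝ 2 μ) :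
    Set (StressSpace μ m) :=
  {z | z ∈ tangentDirections D S ∧ Ξ z = 0 ∧ curvature D lam z < ⊤}

theorem aestronglyMeasurable_mul_norm_sq
    (D : EuclideanSpace ℝ (Fin m) →ₗ[ℝ] EuclideanSpace ℝ (Fin n)) (lam : Lp ℝ 2 μ)
    (σ : StressSpace μ m) : AEStronglyMeasurable (fun x => lam x * ‖D (σ x)‖ ^ 2) μ :=
  (Lp.aestronglyMeasurable lam).mul ((memLp_comp_linearMap D σ).1.norm.pow 2)

theorem lowerSemicontinuous_curvature : LowerSemicontinuous (curvature D lam) := by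
  have hDc : Continuous D := D.continuous_of_finiteDimensional
  refine lowerSemicontinuous_lintegral_comp
    (F := fun x y => ENNReal.ofReal (lam x * ‖D y‖ ^ 2)) (fun x => ?_) fun σ => ?_
  · exact ENNReal.continuous_ofReal.comp (continuous_const.mul (hDc.norm.pow 2))
  · exact (aestronglyMeasurable_mul_norm_sq D lam σ).aemeasurable.ennreal_ofReal

theorem curvature_convex (hlam : ∀ᵐ x ∂μ, 0 ≤ lam x) (a b : StressSpace μ m) {α β : ℝ}
    (hα : 0 ≤ α) (hβ : 0 ≤ β) (hαβ : α + β = 1) :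
    curvature D lam (α • a + β • b) ≤
      ENNReal.ofReal α * curvature D lam a + ENNReal.ofReal β * curvature D lam b := by
  unfold curvature
  rw [← lintegral_const_mul'' _
      (aestronglyMeasurable_mul_norm_sq D lam a).aemeasurable.ennreal_ofReal,
    ← lintegral_const_mul'' _
      (aestronglyMeasurable_mul_norm_sq D lam b).aemeasurable.ennreal_ofReal,
    ← lintegral_add_left'
      ((aestronglyMeasurable_mul_norm_sq D lam a).aemeasurable.ennreal_ofReal.const_mul _)]
  refine lintegral_mono_ae ?_
  filter_upwards [hlam, map_add_ae D (α • a) (β • b), map_smul_ae D α a, map_smul_ae D β b]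
    with x h0 h1 h2 h3
  rw [← ENNReal.ofReal_mul hα, ← ENNReal.ofReal_mul hβ,
    ← ENNReal.ofReal_add (by positivity) (by positivity), h1, h2, h3]
  refine ENNReal.ofReal_le_ofReal ?_
  have h4 : ‖α • D (a x) + β • D (b x)‖ ^ 2 ≤ α * ‖D (a x)‖ ^ 2 + β * ‖D (b x)‖ ^ 2 := by
    have h5 : ‖α • D (a x) + β • D (b x)‖ ≤ α * ‖D (a x)‖ + β * ‖D (b x)‖ := by
      refine (norm_add_le _ _).trans_eq ?_
      rw [norm_smul, norm_smul, Real.norm_of_nonneg hα, Real.norm_of_nonneg hβ]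
    calc ‖α • D (a x) + β • D (b x)‖ ^ 2 ≤ (α * ‖D (a x)‖ + β * ‖D (b x)‖) ^ 2 := by gcongr
      _ = α * ‖D (a x)‖ ^ 2 + β * ‖D (b x)‖ ^ 2 - α * β * (‖D (a x)‖ - ‖D (b x)‖) ^ 2 := by
          have : β = 1 - α := by linarith
          subst this
          ring
      _ ≤ _ := by
          have : 0 ≤ α * β * (‖D (a x)‖ - ‖D (b x)‖) ^ 2 := by positivity
          linarith
  nlinarith [mul_le_mul_of_nonneg_left h4 h0]

theorem curvature_eq_of_ae {a b : StressSpace μ m} (h : ∀ᵐ x ∂μ, D (a x) = D (b x)) :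
    curvature D lam a = curvature D lam b := by
  refine lintegral_congr_ae ?_
  filter_upwards [h] with x hx
  rw [hx]

theorem map_add_deviatorKernel_ae (z : StressSpace μ m) {h : StressSpace μ m}
    (hh : h ∈ deviatorKernel μ D) : ∀ᵐ x ∂μ, D ((z + h) x) = D (z x) := by
  filter_upwards [hh, map_add_ae D z h] with x h1 h2
  rw [h2, norm_eq_zero.1 h1, add_zero]

theorem IsNormalMultiplier.map_deviatorKernel (hlam : IsNormalMultiplier D S Ξ lam)
    {h : StressSpace μ m} (hh : h ∈ deviatorKernel μ D) : Ξ h = 0 := by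
  rw [hlam.2.2]
  refine integral_eq_zero_of_ae ?_
  filter_upwards [hh] with x hx
  simp [norm_eq_zero.1 hx]

theorem add_mem_tangentDirections {z h : StressSpace μ m} (hz : z ∈ tangentDirections D S)
    (hh : h ∈ deviatorKernel μ D) : z + h ∈ tangentDirections D S := by
  change ∀ᵐ x ∂μ, _
  filter_upwards [hz, map_add_deviatorKernel_ae z hh] with x h1 h2
  rwa [h2]

theorem add_mem_admissibleSet {T h : StressSpace μ m} (hT : T ∈ admissibleSet μ D)
    (hh : h ∈ deviatorKernel μ D) : T + h ∈ admissibleSet μ D := by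
  change ∀ᵐ x ∂μ, _
  filter_upwards [hT, map_add_deviatorKernel_ae T hh] with x h1 h2
  rwa [h2]

theorem add_mem_curvatureCone (hlam : IsNormalMultiplier D S Ξ lam) {z h : StressSpace μ m}
    (hz : z ∈ curvatureCone D S Ξ lam) (hh : h ∈ deviatorKernel μ D) :
    z + h ∈ curvatureCone D S Ξ lam := by
  refine ⟨add_mem_tangentDirections hz.1 hh, ?_, ?_⟩
  · rw [map_add, hz.2.1, hlam.map_deviatorKernel hh, add_zero]
  · rw [curvature_eq_of_ae (map_add_deviatorKernel_ae z hh)]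
    exact hz.2.2

theorem convex_curvatureCone (hlam : IsNormalMultiplier D S Ξ lam) :
    Convex ℝ (curvatureCone D S Ξ lam) := by
  intro a ha b hb α β hα hβ hαβ
  refine ⟨smul_add_smul_mem_tangentDirections ha.1 hb.1 hα hβ, ?_, ?_⟩
  · simp [ha.2.1, hb.2.1]
  · refine (curvature_convex hlam.1 a b hα hβ hαβ).trans_lt ?_
    exact ENNReal.add_lt_top.2 ⟨ENNReal.mul_lt_top ENNReal.ofReal_lt_top ha.2.2,
      ENNReal.mul_lt_top ENNReal.ofReal_lt_top hb.2.2⟩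

theorem integrable_mul_norm_sq (hlam : ∀ᵐ x ∂μ, 0 ≤ lam x) {z : StressSpace μ m}
    (hz : curvature D lam z < ⊤) : Integrable (fun x => lam x * ‖D (z x)‖ ^ 2) μ := by
  refine ⟨aestronglyMeasurable_mul_norm_sq D lam z, ?_⟩
  rw [hasFiniteIntegral_iff_ofReal]
  · exact hz
  · filter_upwards [hlam] with x hx
    exact mul_nonneg hx (sq_nonneg _)

theorem ofReal_integral_mul_norm_sq (hlam : ∀ᵐ x ∂μ, 0 ≤ lam x) {z : StressSpace μ m}
    (hz : curvature D lam z < ⊤) :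
    ENNReal.ofReal (∫ x, lam x * ‖D (z x)‖ ^ 2 ∂μ) = curvature D lam z := by
  refine ofReal_integral_eq_lintegral_ofReal (integrable_mul_norm_sq hlam hz) ?_
  filter_upwards [hlam] with x hx
  exact mul_nonneg hx (sq_nonneg _)

theorem integral_mul_norm_sq_nonneg (hlam : ∀ᵐ x ∂μ, 0 ≤ lam x) (z : StressSpace μ m) :
    0 ≤ ∫ x, lam x * ‖D (z x)‖ ^ 2 ∂μ := by
  refine integral_nonneg_of_ae ?_
  filter_upwards [hlam] with x hx
  exact mul_nonneg hx (sq_nonneg _)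

theorem integrable_mul_inner_of_curvature (hlam : ∀ᵐ x ∂μ, 0 ≤ lam x) {a b : StressSpace μ m}
    (ha : curvature D lam a < ⊤) (hb : curvature D lam b < ⊤) :
    Integrable (fun x => lam x * inner ℝ (D (a x)) (D (b x))) μ := by
  refine ((integrable_mul_norm_sq hlam ha).add (integrable_mul_norm_sq hlam hb)).mono'
    ((Lp.aestronglyMeasurable lam).mul
      ((memLp_comp_linearMap D a).1.inner (memLp_comp_linearMap D b).1)) ?_
  filter_upwards [hlam] with x hx
  rw [norm_mul, Real.norm_of_nonneg hx, Pi.add_apply, ← mul_add]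
  gcongr
  refine (norm_inner_le_norm _ _).trans ?_
  nlinarith [sq_nonneg (‖D (a x)‖ - ‖D (b x)‖), sq_nonneg ‖D (a x)‖, sq_nonneg ‖D (b x)‖]

/-- Along an admissible step in direction `w`, the first-order term `-Ξ w` is at least `t / 2` times
the curvature of `w`: expand `|D S + t D w|² ≤ 1` where `|D S| = 1`. -/
theorem curvature_le_of_admissible (hS : S ∈ admissibleSet μ D)
    (hlam : IsNormalMultiplier D S Ξ lam) {t : ℝ} (ht : 0 < t) {w : StressSpace μ m}
    (hw : S + t • w ∈ admissibleSet μ D) :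
    w ∈ tangentDirections D S ∧ curvature D lam w ≤ ENNReal.ofReal (-2 * Ξ w / t) := by
  have hpt : ∀ᵐ x ∂μ, ‖D (S x)‖ = 1 → t * ‖D (w x)‖ ^ 2 ≤ -2 * inner ℝ (D (S x)) (D (w x)) := by
    filter_upwards [hw, map_add_ae D S (t • w), map_smul_ae D t w] with x h1 h2 h3 h4
    rw [h2, h3] at h1
    have h5 := norm_add_smul_sq (D (S x)) (D (w x)) t
    have h6 : ‖D (S x) + t • D (w x)‖ ^ 2 ≤ 1 := pow_le_one₀ (norm_nonneg _) h1
    rw [h5, h4] at h6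
    have h7 : t * (t * ‖D (w x)‖ ^ 2) ≤ t * (-2 * inner ℝ (D (S x)) (D (w x))) := by linarith
    exact le_of_mul_le_mul_left h7 ht
  refine ⟨?_, ?_⟩
  · change ∀ᵐ x ∂μ, _
    filter_upwards [hpt] with x h1 h2
    have h3 := h1 h2
    have h4 : 0 ≤ t * ‖D (w x)‖ ^ 2 := by positivity
    linarith
  · have hptl : ∀ᵐ x ∂μ, lam x * ‖D (w x)‖ ^ 2 ≤
        -2 / t * (lam x * inner ℝ (D (S x)) (D (w x))) := by
      filter_upwards [hpt, hlam.1, hlam.2.1] with x h1 h2 h3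
      by_cases hx : ‖D (S x)‖ = 1
      · have h4 := h1 hx
        have h5 : ‖D (w x)‖ ^ 2 ≤ -2 / t * inner ℝ (D (S x)) (D (w x)) := by
          rw [div_mul_eq_mul_div, le_div_iff₀ ht]
          linarith
        calc lam x * ‖D (w x)‖ ^ 2 ≤ lam x * (-2 / t * inner ℝ (D (S x)) (D (w x))) := by gcongr
          _ = _ := by ring
      · simp [h3 hx]
    have hint := (integrable_mul_inner hS lam w).const_mul (-2 / t)
    have hval : -2 * Ξ w / t = ∫ x, -2 / t * (lam x * inner ℝ (D (S x)) (D (w x))) ∂μ := by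
      rw [integral_const_mul, ← hlam.2.2]; ring
    rw [hval, ofReal_integral_eq_lintegral_ofReal hint]
    · refine lintegral_mono_ae ?_
      filter_upwards [hptl] with x hx
      exact ENNReal.ofReal_le_ofReal hx
    · filter_upwards [hptl, hlam.1] with x hx h0
      exact le_trans (mul_nonneg h0 (sq_nonneg _)) hx

/-- Elements of the explicit critical cone have recovery sequences for the second subderivative. -/
theorem exists_recovery_curvature (hS : S ∈ admissibleSet μ D)
    (hlam : IsNormalMultiplier D S Ξ lam) {z : StressSpace μ m}
    (hz : z ∈ curvatureCone D S Ξ lam) :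
    ∃ w : ℝ → StressSpace μ m, Tendsto w (𝓝[>] 0) (𝓝 z) ∧ ∀ t, 0 < t →
      S + t • w t ∈ admissibleSet μ D ∧
        -2 * Ξ (w t) / t ≤ ∫ x, lam x * ‖D (z x)‖ ^ 2 ∂μ := by
  obtain ⟨hzT, hz0, hzfin⟩ := hz
  obtain ⟨w, hw, hw'⟩ := exists_recovery hS hzT
  -- `Ξ z = 0` forces `z` to be tangential to the sphere where the multiplier is active
  have horth : ∀ᵐ x ∂μ, lam x * inner ℝ (D (S x)) (D (z x)) = 0 := by
    have h1 : 0 ≤ᵐ[μ] fun x => -(lam x * inner ℝ (D (S x)) (D (z x))) := by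
      filter_upwards [hlam.1, hlam.2.1, hzT] with x h1 h2 h3
      by_cases hx : ‖D (S x)‖ = 1
      · exact neg_nonneg.2 (mul_nonpos_of_nonneg_of_nonpos h1 (h3 hx))
      · simp [h2 hx]
    have h2 : ∫ x, -(lam x * inner ℝ (D (S x)) (D (z x))) ∂μ = 0 := by
      rw [integral_neg, ← hlam.2.2, hz0, neg_zero]
    filter_upwards [(integral_eq_zero_iff_of_nonneg_ae h1
      (integrable_mul_inner hS lam z).neg).1 h2] with x hx
    exact neg_eq_zero.1 hx
  refine ⟨w, hw, fun t ht => ⟨(hw' t ht).1, ?_⟩⟩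
  have hval : -2 * Ξ (w t) / t = ∫ x, -2 / t * (lam x * inner ℝ (D (S x)) (D (w t x))) ∂μ := by
    rw [integral_const_mul, ← hlam.2.2]; ring
  rw [hval]
  refine integral_mono_ae ((integrable_mul_inner hS lam (w t)).const_mul _)
    (integrable_mul_norm_sq hlam.1 hzfin) ?_
  filter_upwards [(hw' t ht).2, horth, hlam.1, hlam.2.1] with x h1 h2 h3 h4
  by_cases h0 : lam x = 0
  · simp [h0]
  · have h5 : ‖D (S x)‖ = 1 := by_contra fun h => h0 (h4 h)
    have h6 := h1 h5 ((mul_eq_zero.1 h2).resolve_left h0)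
    have h7 : -2 / t * inner ℝ (D (S x)) (D (w t x)) ≤ ‖D (z x)‖ ^ 2 := by
      rw [div_mul_eq_mul_div, div_le_iff₀ ht]
      linarith
    calc -2 / t * (lam x * inner ℝ (D (S x)) (D (w t x)))
        = lam x * (-2 / t * inner ℝ (D (S x)) (D (w t x))) := by ring
      _ ≤ lam x * ‖D (z x)‖ ^ 2 := by gcongr

theorem indicator_quotient_of_mem {X : Type*} [NormedAddCommGroup X] [NormedSpace ℝ X]
    {K : Set X} {x w : X} {g : StrongDual ℝ X} {t : ℝ} (ht : 0 < t) (hx : x ∈ K)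
    (hw : x + t • w ∈ K) :
    (indicatorFunction K (x + t • w) - indicatorFunction K x - ((t * g w : ℝ) : EReal)) /
      ((t ^ 2 / 2 : ℝ) : EReal) = ((-2 * g w / t : ℝ) : EReal) := by
  have h : -2 * g w / t = -(t * g w) / (t ^ 2 / 2) := by field_simp
  simp only [indicatorFunction, hx, hw, if_true, sub_zero, zero_sub]
  rw [h, ← EReal.coe_neg, ← EReal.coe_div]

theorem indicator_quotient_of_notMem {X : Type*} [NormedAddCommGroup X] [NormedSpace ℝ X]
    {K : Set X} {x w : X} {g : StrongDual ℝ X} {t : ℝ} (ht : 0 < t) (hx : x ∈ K)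
    (hw : x + t • w ∉ K) :
    (indicatorFunction K (x + t • w) - indicatorFunction K x - ((t * g w : ℝ) : EReal)) /
      ((t ^ 2 / 2 : ℝ) : EReal) = ⊤ := by
  have h0 : (0 : ℝ) < t ^ 2 / 2 := by positivity
  simp only [indicatorFunction, hx, hw, if_true, if_false, sub_zero, EReal.top_sub_coe]
  exact EReal.top_div_of_pos_ne_top (by exact_mod_cast h0) (EReal.coe_ne_top _)

theorem isClosed_tangentDirections_curvature_le (M : ENNReal) :
    IsClosed {z | z ∈ tangentDirections D S ∧ curvature D lam z ≤ M} :=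
  (isClosed_tangentDirections D S).inter (lowerSemicontinuous_curvature.isClosed_preimage M)

theorem convex_tangentDirections_curvature_le (hlam : ∀ᵐ x ∂μ, 0 ≤ lam x) (M : ENNReal) :
    Convex ℝ {z | z ∈ tangentDirections D S ∧ curvature D lam z ≤ M} := by
  intro a ha b hb α β hα hβ hαβ
  refine ⟨smul_add_smul_mem_tangentDirections ha.1 hb.1 hα hβ, ?_⟩
  refine (curvature_convex hlam a b hα hβ hαβ).trans ?_
  calc ENNReal.ofReal α * curvature D lam a + ENNReal.ofReal β * curvature D lam b
      ≤ ENNReal.ofReal α * M + ENNReal.ofReal β * M := by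
        gcongr
        exacts [ha.2, hb.2]
    _ = M := by rw [← add_mul, ← ENNReal.ofReal_add hα hβ, hαβ, ENNReal.ofReal_one, one_mul]

/-- The reduced critical cone of the admissible set. That it is not larger than the explicit cone
rests on weak closedness of the convex sublevel sets of the curvature. -/
theorem reducedCriticalCone_eq_curvatureCone (hS : S ∈ admissibleSet μ D)
    (hΞ : ∀ T ∈ admissibleSet μ D, Ξ (T - S) ≤ 0) (hlam : IsNormalMultiplier D S Ξ lam) :
    reducedCriticalCone (indicatorFunction (admissibleSet μ D)) S Ξ =
      curvatureCone D S Ξ lam := by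
  ext z
  constructor
  · intro hz
    rw [reducedCriticalCone, Set.mem_ofPred_eq, secondSubderivative] at hz
    obtain ⟨r, ⟨t, w, ht, ht0, hw, rfl⟩, hr⟩ := sInf_lt_iff.1 hz
    obtain ⟨M, hM, -⟩ := EReal.lt_iff_exists_real_btwn.1 hr
    have hfreq : ∃ᶠ k in atTop, S + t k • w k ∈ admissibleSet μ D ∧ -2 * Ξ (w k) / t k < M := by
      refine (frequently_lt_of_liminf_lt (by isBoundedDefault) hM).mono fun k hk => ?_
      by_cases hmem : S + t k • w k ∈ admissibleSet μ D
      · rw [indicator_quotient_of_mem (ht k) hS hmem] at hk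
        exact ⟨hmem, by exact_mod_cast hk⟩
      · rw [indicator_quotient_of_notMem (ht k) hS hmem] at hk
        exact absurd hk not_top_lt
    have hzM := mem_of_weaklyConverges_of_frequently
      (convex_tangentDirections_curvature_le hlam.1 (ENNReal.ofReal M))
      (isClosed_tangentDirections_curvature_le _) hw (z := z) (hfreq.mono fun k hk => by
        have h1 := curvature_le_of_admissible hS hlam (ht k) hk.1
        exact ⟨h1.1, h1.2.trans (ENNReal.ofReal_le_ofReal hk.2.le)⟩)
    refine ⟨hzM.1, le_antisymm (nonpos_of_mem_tangentDirections hS hΞ hzM.1) ?_,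
      hzM.2.trans_lt ENNReal.ofReal_lt_top⟩
    have hlim : Tendsto (fun k => Ξ (w k) + M / 2 * t k) atTop (𝓝 (Ξ z + M / 2 * 0)) :=
      (hw Ξ).add (ht0.const_mul _)
    rw [mul_zero, add_zero] at hlim
    by_contra hneg
    obtain ⟨k, hk, hk'⟩ :=
      (hfreq.and_eventually (hlim.eventually (gt_mem_nhds (not_le.1 hneg)))).exists
    have h1 := (div_lt_iff₀ (ht k)).1 hk.2
    linarith
  · intro hz
    obtain ⟨w, hw, hw'⟩ := exists_recovery_curvature hS hlam hz
    have ht : ∀ k : ℕ, (0 : ℝ) < 1 / ((k : ℝ) + 1) := fun k => by positivity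
    have hlim : Tendsto (fun k : ℕ => 1 / ((k : ℝ) + 1)) atTop (𝓝[>] 0) :=
      tendsto_nhdsWithin_iff.2
        ⟨tendsto_one_div_add_atTop_nhds_zero_nat, Eventually.of_forall ht⟩
    rw [reducedCriticalCone, Set.mem_ofPred_eq, secondSubderivative]
    refine lt_of_le_of_lt (sInf_le ⟨fun k : ℕ => 1 / ((k : ℝ) + 1), fun k => w (1 / ((k : ℝ) + 1)),
      ht, tendsto_one_div_add_atTop_nhds_zero_nat,
      fun φ => (φ.continuous.tendsto z).comp (hw.comp hlim), rfl⟩) ?_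
    refine lt_of_le_of_lt ?_ (EReal.coe_lt_top (∫ x, lam x * ‖D (z x)‖ ^ 2 ∂μ))
    refine liminf_le_of_frequently_le' (Eventually.frequently (Eventually.of_forall fun k => ?_))
    rw [indicator_quotient_of_mem (ht k) hS (hw' _ (ht k)).1]
    exact_mod_cast (hw' _ (ht k)).2

end Curvature

/-! ### Existence, uniqueness and multipliers for the stress problem -/

section Solution

variable {Ω : Type*} [MeasurableSpace Ω] {μ : Measure Ω} {m n : ℕ} {V : Type*}
  [NormedAddCommGroup V] [InnerProductSpace ℝ V]
  {A : StressSpace μ m →L[ℝ] StrongDual ℝ (StressSpace μ m)}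
  {B : StressSpace μ m →L[ℝ] StrongDual ℝ V}
  {D : EuclideanSpace ℝ (Fin m) →ₗ[ℝ] EuclideanSpace ℝ (Fin n)}
  {R : StrongDual ℝ V →L[ℝ] StressSpace μ m}

/-- `deviatorKernel` as a submodule. -/
def deviatorSubmodule (μ : Measure Ω)
    (D : EuclideanSpace ℝ (Fin m) →ₗ[ℝ] EuclideanSpace ℝ (Fin n)) :
    Submodule ℝ (StressSpace μ m) where
  carrier := deviatorKernel μ D
  zero_mem' := by
    change ∀ᵐ x ∂μ, _
    filter_upwards [Lp.coeFn_zero (EuclideanSpace ℝ (Fin m)) 2 μ] with x hx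
    change ‖D ((0 : StressSpace μ m) x)‖ = 0
    rw [hx, Pi.zero_apply, map_zero, norm_zero]
  add_mem' := by
    intro a b ha hb
    change ∀ᵐ x ∂μ, _
    filter_upwards [ha, map_add_deviatorKernel_ae a hb] with x h1 h2
    rw [h2, h1]
  smul_mem' := by
    intro r a ha
    change ∀ᵐ x ∂μ, _
    filter_upwards [ha, map_smul_ae D r a] with x h1 h2
    rw [h2, norm_smul, h1, mul_zero]

theorem isClosed_deviatorKernel : IsClosed (deviatorKernel μ D) := by
  have hDc : Continuous D := D.continuous_of_finiteDimensional
  exact isClosed_setOf_ae (P := fun _ y => ‖D y‖ = 0) fun _ =>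
    isClosed_eq hDc.norm continuous_const

theorem isClosed_admissibleSet : IsClosed (admissibleSet μ D) := by
  have hDc : Continuous D := D.continuous_of_finiteDimensional
  exact isClosed_setOf_ae (P := fun _ y => ‖D y‖ ≤ 1) fun _ =>
    isClosed_le hDc.norm continuous_const

theorem convex_admissibleSet : Convex ℝ (admissibleSet μ D) := by
  intro a ha b hb α β hα hβ hαβ
  change ∀ᵐ x ∂μ, _
  filter_upwards [ha, hb, map_add_ae D (α • a) (β • b), map_smul_ae D α a, map_smul_ae D β b]
    with x h1 h2 h3 h4 h5
  rw [h3, h4, h5]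
  calc ‖α • D (a x) + β • D (b x)‖ ≤ ‖α • D (a x)‖ + ‖β • D (b x)‖ := norm_add_le _ _
    _ = α * ‖D (a x)‖ + β * ‖D (b x)‖ := by
        rw [norm_smul, norm_smul, Real.norm_of_nonneg hα, Real.norm_of_nonneg hβ]
    _ ≤ α * 1 + β * 1 := by gcongr
    _ = 1 := by rw [mul_one, mul_one, hαβ]

theorem deviatorKernel_subset_admissibleSet : deviatorKernel μ D ⊆ admissibleSet μ D := by
  intro h hh
  change ∀ᵐ x ∂μ, _
  filter_upwards [hh] with x hx
  rw [hx]
  exact zero_le_one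

theorem exists_rightInverse_deviatorKernel
    (hB : Set.SurjOn B (deviatorKernel μ D) Set.univ) :
    ∃ R : StrongDual ℝ V →L[ℝ] StressSpace μ m, ∀ φ, R φ ∈ deviatorKernel μ D ∧ B (R φ) = φ := by
  let H := deviatorSubmodule μ D
  have hH : IsClosed (H : Set (StressSpace μ m)) := isClosed_deviatorKernel
  have : CompleteSpace H := hH.completeSpace_coe
  obtain ⟨g, hg⟩ := exists_continuousLinear_rightInverse (B.comp H.subtypeL) fun φ => by
    obtain ⟨h, hh, hφ⟩ := hB (Set.mem_univ φ)
    exact ⟨⟨h, hh⟩, hφ⟩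
  exact ⟨H.subtypeL.comp g, fun φ => ⟨(g φ).2, hg φ⟩⟩

theorem eq_of_forall_strongDual_eq {u v : V} (h : ∀ φ : StrongDual ℝ V, φ u = φ v) : u = v :=
  ext_inner_left ℝ fun w => h (innerSL ℝ w)

/-- The multiplier of a stress `S` depends linearly and continuously on `S`: it is determined by
testing the state equation with the kernel directions `R φ`. -/
theorem exists_multiplierMap [CompleteSpace V]
    (A : StressSpace μ m →L[ℝ] StrongDual ℝ (StressSpace μ m))
    (R : StrongDual ℝ V →L[ℝ] StressSpace μ m) :
    ∃ U : StressSpace μ m →L[ℝ] V, ∀ S φ, φ (U S) = -(A S (R φ)) := by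
  let J : V →L[ℝ] StrongDual ℝ V := innerSL ℝ
  let f : StressSpace μ m → StrongDual ℝ V := fun S => -((A S).comp (R.comp J))
  have hu : ∀ S φ, φ ((InnerProductSpace.toDual ℝ V).symm (f S)) = -(A S (R φ)) := by
    intro S φ
    set v := (InnerProductSpace.toDual ℝ V).symm φ
    have hφ : φ = J v := by
      ext w
      change φ w = inner ℝ v w
      rw [InnerProductSpace.toDual_symm_apply]
    rw [hφ]
    change inner ℝ v _ = _
    rw [real_inner_comm, InnerProductSpace.toDual_symm_apply]
    rfl
  let L : StressSpace μ m →ₗ[ℝ] V :=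
    { toFun := fun S => (InnerProductSpace.toDual ℝ V).symm (f S)
      map_add' := fun S T => eq_of_forall_strongDual_eq fun φ => by
        rw [map_add, hu, hu, hu, map_add, add_apply]
        ring
      map_smul' := fun r S => eq_of_forall_strongDual_eq fun φ => by
        rw [map_smul, hu, hu, map_smul, smul_apply]
        simp }
  refine ⟨L.mkContinuous (‖A‖ * ‖R.comp J‖) fun S => ?_, hu⟩
  change ‖(InnerProductSpace.toDual ℝ V).symm (f S)‖ ≤ _
  rw [LinearIsometryEquiv.norm_map, norm_neg]
  calc ‖(A S).comp (R.comp J)‖ ≤ ‖A S‖ * ‖R.comp J‖ := ContinuousLinearMap.opNorm_comp_le _ _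
    _ ≤ ‖A‖ * ‖S‖ * ‖R.comp J‖ := by gcongr; exact A.le_opNorm S
    _ = _ := by ring

theorem IsStressSolution.nonneg (hAsymm : ∀ S T, A S T = A T S) {ℓ : StrongDual ℝ V}
    {S : StressSpace μ m} (hS : IsStressSolution A B D ℓ S) {T : StressSpace μ m}
    (hT : T ∈ admissibleSet μ D) (hBT : B T = ℓ) : 0 ≤ A S (T - S) := by
  have h : ∀ θ : ℝ, 0 < θ → θ ≤ 1 →
      0 ≤ θ * A S (T - S) + θ ^ 2 * (1 / 2 * A (T - S) (T - S)) := by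
    intro θ hθ hθ1
    have h1 : S + θ • (T - S) ∈ admissibleSet μ D :=
      convex_admissibleSet.add_smul_sub_mem hS.1 hT ⟨hθ.le, hθ1⟩
    have h2 : B (S + θ • (T - S)) = ℓ := by
      rw [map_add, map_smul, map_sub, hBT, hS.2.1, sub_self, smul_zero, add_zero]
    have h3 := hS.2.2 _ h1 h2
    have h4 : A (S + θ • (T - S)) (S + θ • (T - S)) =
        A S S + 2 * (θ * A S (T - S)) + θ ^ 2 * A (T - S) (T - S) := by
      have := hAsymm (T - S) S
      simp only [map_add, map_smul, add_apply, smul_apply, smul_eq_mul, this]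
      ring
    rw [h4] at h3
    linarith
  exact nonneg_of_forall_mul_add_sq_mul_nonneg h

theorem eq_of_coercive {c : ℝ} (hc : 0 < c) (hA : ∀ x, c * ‖x‖ ^ 2 ≤ A x x)
    {S T : StressSpace μ m} (h : A (S - T) (S - T) ≤ 0) : S = T := by
  have h1 := (hA (S - T)).trans h
  have h2 : ‖S - T‖ ^ 2 ≤ 0 := nonpos_of_mul_nonpos_right h1 hc
  have h3 : ‖S - T‖ = 0 := pow_eq_zero_iff two_ne_zero |>.1 (le_antisymm h2 (sq_nonneg _))
  exact sub_eq_zero.1 (norm_eq_zero.1 h3)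

theorem IsStressSolution.unique (hAsymm : ∀ S T, A S T = A T S) {c : ℝ} (hc : 0 < c)
    (hA : ∀ x, c * ‖x‖ ^ 2 ≤ A x x) {ℓ : StrongDual ℝ V} {S T : StressSpace μ m}
    (hS : IsStressSolution A B D ℓ S) (hT : IsStressSolution A B D ℓ T) : S = T := by
  refine eq_of_coercive hc hA ?_
  have h1 := hS.nonneg hAsymm hT.1 hT.2.1
  have h2 := hT.nonneg hAsymm hS.1 hS.2.1
  simp only [map_sub, sub_apply] at h1 h2 ⊢
  linarith

theorem exists_isStressSolution {c : ℝ} (hc : 0 < c) (hA : ∀ x, c * ‖x‖ ^ 2 ≤ A x x)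
    (hR : ∀ φ, R φ ∈ deviatorKernel μ D ∧ B (R φ) = φ) (ℓ : StrongDual ℝ V) :
    ∃ S, IsStressSolution A B D ℓ S := by
  have hAnn : ∀ x, 0 ≤ A x x := fun x => le_trans (by positivity) (hA x)
  have hAc : Continuous fun S : StressSpace μ m => ENNReal.ofReal (A S S) :=
    ENNReal.continuous_ofReal.comp (A.continuous.clm_apply continuous_id)
  obtain ⟨z, hz, hmin, -⟩ := exists_minimizer_iSup
    (C := {S | S ∈ admissibleSet μ D ∧ B S = ℓ})
    (isClosed_admissibleSet.inter (isClosed_eq B.continuous continuous_const))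
    (fun a ha b hb => ⟨convex_admissibleSet.midpoint_mem ha.1 hb.1, by
      rw [midpoint_eq_smul_add, map_smul, map_add, ha.2, hb.2, ← two_smul ℝ, smul_smul]
      simp⟩)
    (G := fun _ S => ENNReal.ofReal (A S S)) (fun _ _ _ => le_rfl)
    (fun _ => hAc.lowerSemicontinuous) (c := c / 4) (by positivity)
    (fun _ a _ b _ => ofReal_midpoint_add_le hc.le hA a b)
    (x₀ := R ℓ) ⟨deviatorKernel_subset_admissibleSet (hR ℓ).1, (hR ℓ).2⟩
    (by rw [iSup_const]; exact ENNReal.ofReal_ne_top)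
  refine ⟨z, hz.1, hz.2, fun T hT hBT => ?_⟩
  have h := hmin T ⟨hT, hBT⟩
  rw [iSup_const, iSup_const, ENNReal.ofReal_le_ofReal_iff (hAnn T)] at h
  linarith

theorem nonneg_of_multiplier (hAsymm : ∀ S T, A S T = A T S)
    (hR : ∀ φ, R φ ∈ deviatorKernel μ D ∧ B (R φ) = φ) {ℓ : StrongDual ℝ V}
    {S : StressSpace μ m} (hS : IsStressSolution A B D ℓ S) {u : V}
    (hu : ∀ φ, φ u = -(A S (R φ))) {T : StressSpace μ m} (hT : T ∈ admissibleSet μ D) :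
    0 ≤ (A S + B.flip u) (T - S) := by
  -- correct `T` by a kernel direction so that it satisfies the equality constraint
  have h1 := hS.nonneg hAsymm (add_mem_admissibleSet hT (hR (ℓ - B T)).1)
    (by rw [map_add, (hR _).2]; abel)
  have h2 := hu (ℓ - B T)
  simp only [map_sub, map_add, add_apply, sub_apply, ContinuousLinearMap.flip_apply, hS.2.1]
    at h1 h2 ⊢
  linarith

theorem saddlePointVI_iff (hAsymm : ∀ S T, A S T = A T S)
    (hR : ∀ φ, R φ ∈ deviatorKernel μ D ∧ B (R φ) = φ) {ℓ : StrongDual ℝ V}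
    {S : StressSpace μ m} (hS : IsStressSolution A B D ℓ S) {u : V} :
    SaddlePointVI A B D ℓ S u ↔ ∀ φ, φ u = -(A S (R φ)) := by
  constructor
  · intro h
    have h1 : ∀ φ, 0 ≤ A S (R φ) + φ u := fun φ => by
      have := h _ (add_mem_admissibleSet hS.1 (hR φ).1) u
      rw [add_sub_cancel_left, sub_self, map_zero, sub_zero, add_apply,
        ContinuousLinearMap.flip_apply, (hR φ).2] at this
      exact this
    intro φ
    have h2 := h1 (-φ)
    rw [map_neg, map_neg, neg_apply] at h2
    linarith [h1 φ]
  · intro hu T hT v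
    rw [hS.2.1, sub_self, zero_apply, sub_zero]
    exact nonneg_of_multiplier hAsymm hR hS hu hT

end Solution

/-! ### Directional differentiability of the stress -/

section Derivative

variable {Ω : Type*} [MeasurableSpace Ω] {μ : Measure Ω} {m n : ℕ} {V : Type*}
  [NormedAddCommGroup V] [InnerProductSpace ℝ V]
  {A : StressSpace μ m →L[ℝ] StrongDual ℝ (StressSpace μ m)}
  {B : StressSpace μ m →L[ℝ] StrongDual ℝ V}
  {D : EuclideanSpace ℝ (Fin m) →ₗ[ℝ] EuclideanSpace ℝ (Fin n)}
  {R : StrongDual ℝ V →L[ℝ] StressSpace μ m}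
  {S : StressSpace μ m} {Ξ : StrongDual ℝ (StressSpace μ m)} {lam : Lp ℝ 2 μ} {c : ℝ}

/-- Lower bounds for the energies `⟨A σ, σ⟩ - (2 / t) Ξ σ` of admissible difference quotients, valid
once `t ≤ 2 / N`. For `N → ∞` they increase to the energy of the derivative, which is
`⟨A σ, σ⟩ + ∫ lam |D σ|²` if `Ξ σ = 0` and `∞` if `Ξ σ < 0`. -/
def penalizedEnergy (A : StressSpace μ m →L[ℝ] StrongDual ℝ (StressSpace μ m))
    (D : EuclideanSpace ℝ (Fin m) →ₗ[ℝ] EuclideanSpace ℝ (Fin n))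
    (Ξ : StrongDual ℝ (StressSpace μ m)) (lam : Lp ℝ 2 μ) (N : ℕ) (σ : StressSpace μ m) :
    ENNReal :=
  ENNReal.ofReal (A σ σ) + (curvature D lam σ ⊔ N * ENNReal.ofReal (-Ξ σ))

theorem monotone_penalizedEnergy : Monotone (penalizedEnergy A D Ξ lam) := by
  intro N M h σ
  unfold penalizedEnergy
  gcongr

theorem lowerSemicontinuous_penalizedEnergy (N : ℕ) :
    LowerSemicontinuous (penalizedEnergy A D Ξ lam N) := by
  have hAc : Continuous fun S : StressSpace μ m => ENNReal.ofReal (A S S) :=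
    ENNReal.continuous_ofReal.comp (A.continuous.clm_apply continuous_id)
  have hΞc : Continuous fun S : StressSpace μ m => (N : ENNReal) * ENNReal.ofReal (-Ξ S) :=
    (ENNReal.continuous_const_mul (ENNReal.natCast_ne_top N)).comp
      (ENNReal.continuous_ofReal.comp Ξ.continuous.neg)
  exact hAc.lowerSemicontinuous.add
    (lowerSemicontinuous_curvature.sup hΞc.lowerSemicontinuous)

theorem penalizedEnergy_midpoint (hc : 0 ≤ c) (hA : ∀ x, c * ‖x‖ ^ 2 ≤ A x x)
    (hlam : ∀ᵐ x ∂μ, 0 ≤ lam x) (N : ℕ) (a b : StressSpace μ m) :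
    penalizedEnergy A D Ξ lam N (midpoint ℝ a b) + ENNReal.ofReal (c / 4 * ‖a - b‖ ^ 2) ≤
      (penalizedEnergy A D Ξ lam N a + penalizedEnergy A D Ξ lam N b) / 2 := by
  have hhalf : ∀ p q : ENNReal,
      (p + q) / 2 = ENNReal.ofReal (1 / 2) * p + ENNReal.ofReal (1 / 2) * q := fun p q => by
    have h : ENNReal.ofReal (1 / 2) = 2⁻¹ := by
      rw [one_div, ENNReal.ofReal_inv_of_pos two_pos]; simp
    rw [h, div_eq_mul_inv, mul_comm, mul_add]
  have hmid : midpoint ℝ a b = (1 / 2 : ℝ) • a + (1 / 2 : ℝ) • b := by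
    rw [midpoint_eq_smul_add, smul_add]; norm_num
  have h1 := ofReal_midpoint_add_le hc hA a b
  have h2 : curvature D lam (midpoint ℝ a b) ≤ (curvature D lam a + curvature D lam b) / 2 := by
    rw [hmid, hhalf]
    exact curvature_convex hlam a b (by norm_num) (by norm_num) (by norm_num)
  have h3 : ENNReal.ofReal (-Ξ (midpoint ℝ a b)) ≤
      (ENNReal.ofReal (-Ξ a) + ENNReal.ofReal (-Ξ b)) / 2 := by
    rw [hmid, hhalf, ← mul_add]
    have : -Ξ ((1 / 2 : ℝ) • a + (1 / 2 : ℝ) • b) = 1 / 2 * (-Ξ a + -Ξ b) := by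
      rw [map_add, map_smul, map_smul, smul_eq_mul, smul_eq_mul]; ring
    rw [this, ENNReal.ofReal_mul (by norm_num)]
    gcongr
    exact ENNReal.ofReal_add_le
  have h4 : (N : ENNReal) * ENNReal.ofReal (-Ξ (midpoint ℝ a b)) ≤
      (N * ENNReal.ofReal (-Ξ a) + N * ENNReal.ofReal (-Ξ b)) / 2 := by
    rw [← mul_add, mul_div_assoc]
    gcongr
  unfold penalizedEnergy
  rw [add_right_comm]
  calc ENNReal.ofReal (A (midpoint ℝ a b) (midpoint ℝ a b)) +
        ENNReal.ofReal (c / 4 * ‖a - b‖ ^ 2) +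
        (curvature D lam (midpoint ℝ a b) ⊔ N * ENNReal.ofReal (-Ξ (midpoint ℝ a b)))
      ≤ (ENNReal.ofReal (A a a) + ENNReal.ofReal (A b b)) / 2 +
        ((curvature D lam a ⊔ N * ENNReal.ofReal (-Ξ a)) +
          (curvature D lam b ⊔ N * ENNReal.ofReal (-Ξ b))) / 2 := by
        refine add_le_add h1 (sup_le (h2.trans ?_) (h4.trans ?_))
        · gcongr <;> exact le_sup_left
        · gcongr <;> exact le_sup_right
    _ = _ := by rw [← ENNReal.add_div]; congr 1; ring

theorem iSup_penalizedEnergy (hA : ∀ x, 0 ≤ A x x) (hlam : ∀ᵐ x ∂μ, 0 ≤ lam x)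
    {z : StressSpace μ m} (hz : z ∈ curvatureCone D S Ξ lam) :
    ⨆ N, penalizedEnergy A D Ξ lam N z =
      ENNReal.ofReal (A z z + ∫ x, lam x * ‖D (z x)‖ ^ 2 ∂μ) := by
  have h : ∀ N, penalizedEnergy A D Ξ lam N z =
      ENNReal.ofReal (A z z + ∫ x, lam x * ‖D (z x)‖ ^ 2 ∂μ) := fun N => by
    rw [ENNReal.ofReal_add (hA z) (integral_mul_norm_sq_nonneg hlam z),
      ofReal_integral_mul_norm_sq hlam hz.2.2]
    simp [penalizedEnergy, hz.2.1]
  simp_rw [h, iSup_const]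

/-- Finiteness of all penalized energies, uniformly in the penalty, characterizes the cone. -/
theorem mem_curvatureCone_of_iSup_ne_top {z : StressSpace μ m} (hzT : z ∈ tangentDirections D S)
    (hΞz : Ξ z ≤ 0) (hfin : ⨆ N, penalizedEnergy A D Ξ lam N z ≠ ⊤) :
    z ∈ curvatureCone D S Ξ lam := by
  refine ⟨hzT, le_antisymm hΞz ?_, ?_⟩
  · by_contra hneg
    have h1 : ENNReal.ofReal (-Ξ z) ≠ 0 := by
      rw [Ne, ENNReal.ofReal_eq_zero]; linarith
    obtain ⟨N, hN⟩ := ENNReal.exists_nat_mul_gt h1 hfin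
    refine absurd (le_iSup (fun N => penalizedEnergy A D Ξ lam N z) N) (not_le.2 (hN.trans_le ?_))
    exact le_sup_right.trans le_add_self
  · refine lt_of_le_of_lt ?_ (lt_top_iff_ne_top.2 hfin)
    refine le_trans ?_ (le_iSup (fun N => penalizedEnergy A D Ξ lam N z) 0)
    exact le_sup_left.trans le_add_self

theorem curvature_sub_lt_top (hlam : ∀ᵐ x ∂μ, 0 ≤ lam x) {a b : StressSpace μ m}
    (ha : curvature D lam a < ⊤) (hb : curvature D lam b < ⊤) : curvature D lam (a - b) < ⊤ := by
  refine Integrable.lintegral_lt_top ?_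
  refine (((integrable_mul_norm_sq hlam ha).const_mul 2).add
    ((integrable_mul_norm_sq hlam hb).const_mul 2)).mono'
    (aestronglyMeasurable_mul_norm_sq D lam _) ?_
  filter_upwards [hlam, map_sub_ae D a b] with x h0 h1
  rw [Real.norm_of_nonneg (mul_nonneg h0 (sq_nonneg _)), h1, Pi.add_apply]
  have h2 : ‖D (a x) - D (b x)‖ ^ 2 ≤ 2 * ‖D (a x)‖ ^ 2 + 2 * ‖D (b x)‖ ^ 2 := by
    have := parallelogram_law_with_norm ℝ (D (a x)) (D (b x))
    nlinarith [sq_nonneg ‖D (a x) + D (b x)‖]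
  nlinarith [mul_le_mul_of_nonneg_left h2 h0]

/-- Solutions of the linearized inequality for the stress are unique, because `A` is strongly
monotone and the curvature term is monotone. -/
theorem eq_of_linearized (hc : 0 < c) (hA : ∀ x, c * ‖x‖ ^ 2 ≤ A x x)
    (hlam : ∀ᵐ x ∂μ, 0 ≤ lam x) {a b : StressSpace μ m} (ha : curvature D lam a < ⊤)
    (hb : curvature D lam b < ⊤)
    (hab : 0 ≤ A a (b - a) + ∫ x, lam x * inner ℝ (D (a x)) (D ((b - a) x)) ∂μ)
    (hba : 0 ≤ A b (a - b) + ∫ x, lam x * inner ℝ (D (b x)) (D ((a - b) x)) ∂μ) : a = b := by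
  have h1 : (∫ x, lam x * inner ℝ (D (a x)) (D ((b - a) x)) ∂μ) +
      ∫ x, lam x * inner ℝ (D (b x)) (D ((a - b) x)) ∂μ =
      -∫ x, lam x * ‖D ((a - b) x)‖ ^ 2 ∂μ := by
    rw [← integral_add
      (integrable_mul_inner_of_curvature hlam ha (curvature_sub_lt_top hlam hb ha))
      (integrable_mul_inner_of_curvature hlam hb (curvature_sub_lt_top hlam ha hb)),
      ← integral_neg]
    refine integral_congr_ae ?_
    filter_upwards [map_sub_ae D a b, map_sub_ae D b a] with x h1 h2
    rw [h1, h2, ← real_inner_self_eq_norm_sq]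
    simp only [inner_sub_left, inner_sub_right, real_inner_comm (D (a x)) (D (b x))]
    ring
  refine eq_of_coercive hc hA ?_
  have h2 := integral_mul_norm_sq_nonneg (D := D) hlam (a - b)
  simp only [map_sub, sub_apply] at hab hba ⊢
  linarith

/-- First-order condition for minimizers of `⟨A σ, σ⟩ + ∫ lam |D σ|²`. -/
theorem nonneg_of_minimizer (hAsymm : ∀ S T, A S T = A T S) (hlam : ∀ᵐ x ∂μ, 0 ≤ lam x)
    {z T : StressSpace μ m} (hz : curvature D lam z < ⊤) (hT : curvature D lam T < ⊤)
    (hmin : ∀ θ : ℝ, 0 < θ → θ ≤ 1 → A z z + ∫ x, lam x * ‖D (z x)‖ ^ 2 ∂μ ≤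
      A (z + θ • (T - z)) (z + θ • (T - z)) +
        ∫ x, lam x * ‖D ((z + θ • (T - z)) x)‖ ^ 2 ∂μ) :
    0 ≤ A z (T - z) + ∫ x, lam x * inner ℝ (D (z x)) (D ((T - z) x)) ∂μ := by
  have hTz := curvature_sub_lt_top hlam hT hz
  have h : ∀ θ : ℝ, 0 < θ → θ ≤ 1 →
      0 ≤ θ * (2 * (A z (T - z) + ∫ x, lam x * inner ℝ (D (z x)) (D ((T - z) x)) ∂μ)) +
        θ ^ 2 * (A (T - z) (T - z) + ∫ x, lam x * ‖D ((T - z) x)‖ ^ 2 ∂μ) := by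
    intro θ hθ hθ1
    have h1 := hmin θ hθ hθ1
    have h2 : A (z + θ • (T - z)) (z + θ • (T - z)) =
        A z z + 2 * (θ * A z (T - z)) + θ ^ 2 * A (T - z) (T - z) := by
      have := hAsymm (T - z) z
      simp only [map_add, map_smul, add_apply, smul_apply, smul_eq_mul, this]
      ring
    have h3 : ∫ x, lam x * ‖D ((z + θ • (T - z)) x)‖ ^ 2 ∂μ =
        (∫ x, lam x * ‖D (z x)‖ ^ 2 ∂μ) +
          2 * θ * (∫ x, lam x * inner ℝ (D (z x)) (D ((T - z) x)) ∂μ) +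
          θ ^ 2 * ∫ x, lam x * ‖D ((T - z) x)‖ ^ 2 ∂μ := by
      have i1 := integrable_mul_norm_sq hlam hz
      have i2 := (integrable_mul_inner_of_curvature hlam hz hTz).const_mul (2 * θ)
      have i3 := (integrable_mul_norm_sq hlam hTz).const_mul (θ ^ 2)
      have i12 : Integrable (fun x => lam x * ‖D (z x)‖ ^ 2 +
          2 * θ * (lam x * inner ℝ (D (z x)) (D ((T - z) x)))) μ := i1.add i2
      rw [← integral_const_mul, ← integral_const_mul, ← integral_add i1 i2,
        ← integral_add i12 i3]
      refine integral_congr_ae ?_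
      filter_upwards [map_add_ae D z (θ • (T - z)), map_smul_ae D θ (T - z)] with x e1 e2
      rw [e1, e2, norm_add_smul_sq]
      ring
    rw [h2, h3] at h1
    linarith
  have := nonneg_of_forall_mul_add_sq_mul_nonneg h
  linarith

/-- If `S + t σ` solves the stress problem, then `σ` minimizes the expansion of the energy around
`S` among all admissible directions with the same load. -/
theorem energy_le_of_isStressSolution (hAsymm : ∀ S T, A S T = A T S) {ℓ q : StrongDual ℝ V}
    {u : V} (hBS : B S = ℓ) {t : ℝ} (ht : 0 < t) {σ w : StressSpace μ m}
    (hσ : IsStressSolution A B D (ℓ + t • q) (S + t • σ)) (hwK : S + t • w ∈ admissibleSet μ D)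
    (hBw : B w = q) :
    A σ σ + -2 * (-(A S + B.flip u)) σ / t ≤ A w w + -2 * (-(A S + B.flip u)) w / t := by
  have hBσ : B σ = q := by
    have h := hσ.2.1
    rw [map_add, hBS, map_smul] at h
    exact smul_right_injective _ ht.ne' (add_left_cancel h)
  have h1 := hσ.2.2 _ hwK (by rw [map_add, map_smul, hBS, hBw])
  have hexp : ∀ y, A (S + t • y) (S + t • y) = A S S + 2 * (t * A S y) + t ^ 2 * A y y := by
    intro y
    have := hAsymm y S
    simp only [map_add, map_smul, add_apply, smul_apply, smul_eq_mul, this]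
    ring
  rw [hexp, hexp] at h1
  have hval : ∀ y, B y = q → A y y + -2 * (-(A S + B.flip u)) y / t =
      (2 * (t * A S y) + t ^ 2 * A y y + 2 * t * q u) / t ^ 2 := by
    intro y hy
    simp only [neg_apply, add_apply, ContinuousLinearMap.flip_apply, hy]
    field_simp
    ring
  rw [hval σ hBσ, hval w hBw]
  exact div_le_div_of_nonneg_right (by linarith) (sq_nonneg t)

/-- Difference quotients of the stress converge in norm to the minimizer of
`⟨A σ, σ⟩ + ∫ lam |D σ|²` over the critical cone under the linearized equality constraint. -/
theorem exists_stress_derivative (hAsymm : ∀ S T, A S T = A T S) (hc : 0 < c)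
    (hA : ∀ x, c * ‖x‖ ^ 2 ≤ A x x)
    (hR : ∀ φ, R φ ∈ deviatorKernel μ D ∧ B (R φ) = φ)
    {sol : StrongDual ℝ V → StressSpace μ m} (hsol : ∀ ℓ, IsStressSolution A B D ℓ (sol ℓ))
    {ℓ₀ : StrongDual ℝ V} {u : V}
    (hΞ : ∀ T ∈ admissibleSet μ D, (-(A (sol ℓ₀) + B.flip u)) (T - sol ℓ₀) ≤ 0)
    (hlam : IsNormalMultiplier D (sol ℓ₀) (-(A (sol ℓ₀) + B.flip u)) lam)
    (δℓ : StrongDual ℝ V) :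
    ∃ z ∈ curvatureCone D (sol ℓ₀) (-(A (sol ℓ₀) + B.flip u)) lam, B z = δℓ ∧
      (∀ T ∈ curvatureCone D (sol ℓ₀) (-(A (sol ℓ₀) + B.flip u)) lam, B T = δℓ →
        0 ≤ A z (T - z) + ∫ x, lam x * inner ℝ (D (z x)) (D ((T - z) x)) ∂μ) ∧
      HasHadamardDirDeriv sol ℓ₀ δℓ z := by
  have hAnn : ∀ x, 0 ≤ A x x := fun x => le_trans (by positivity) (hA x)
  have hS := (hsol ℓ₀).1
  have hBS := (hsol ℓ₀).2.1
  set S := sol ℓ₀ with hSdef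
  set Ξ : StrongDual ℝ (StressSpace μ m) := -(A S + B.flip u) with hΞdef
  let C : Set (StressSpace μ m) := {σ | σ ∈ tangentDirections D S ∧ B σ = δℓ}
  have hCclosed : IsClosed C :=
    (isClosed_tangentDirections D S).inter (isClosed_eq B.continuous continuous_const)
  have hCmid : ∀ a ∈ C, ∀ b ∈ C, midpoint ℝ a b ∈ C := by
    intro a ha b hb
    rw [midpoint_eq_smul_add, smul_add]
    refine ⟨smul_add_smul_mem_tangentDirections ha.1 hb.1 (by norm_num) (by norm_num), ?_⟩
    rw [map_add, map_smul, map_smul, ha.2, hb.2, ← two_smul ℝ, smul_smul]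
    simp
  have hRcone : R δℓ ∈ curvatureCone D S Ξ lam := by
    refine ⟨deviatorKernel_subset_tangentDirections (hR δℓ).1,
      hlam.map_deviatorKernel (hR δℓ).1, ?_⟩
    have h0 : curvature D lam (R δℓ) = 0 := by
      unfold curvature
      rw [lintegral_congr_ae (g := fun _ => 0), lintegral_zero]
      filter_upwards [(hR δℓ).1] with x hx
      rw [hx]; simp
    rw [h0]
    exact ENNReal.zero_lt_top
  obtain ⟨z, hzC, hzmin, hzconv⟩ := exists_minimizer_iSup hCclosed hCmid
    (G := penalizedEnergy A D Ξ lam) monotone_penalizedEnergy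
    lowerSemicontinuous_penalizedEnergy (c := c / 4) (by positivity)
    (fun N a _ b _ => penalizedEnergy_midpoint hc.le hA hlam.1 N a b)
    (x₀ := R δℓ) ⟨hRcone.1, (hR δℓ).2⟩
    (by rw [iSup_penalizedEnergy hAnn hlam.1 hRcone]; exact ENNReal.ofReal_ne_top)
  have hzcone : z ∈ curvatureCone D S Ξ lam := by
    refine mem_curvatureCone_of_iSup_ne_top (A := A) hzC.1
      (nonpos_of_mem_tangentDirections hS hΞ hzC.1) (ne_top_of_le_ne_top ?_
        (hzmin (R δℓ) ⟨hRcone.1, (hR δℓ).2⟩))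
    rw [iSup_penalizedEnergy hAnn hlam.1 hRcone]
    exact ENNReal.ofReal_ne_top
  have hsupz := iSup_penalizedEnergy hAnn hlam.1 hzcone
  refine ⟨z, hzcone, hzC.2, fun T hT hBT => ?_, fun q hq => ?_⟩
  · refine nonneg_of_minimizer hAsymm hlam.1 hzcone.2.2 hT.2.2 fun θ hθ hθ1 => ?_
    have hmem : z + θ • (T - z) ∈ curvatureCone D S Ξ lam :=
      (convex_curvatureCone hlam).add_smul_sub_mem hzcone hT ⟨hθ.le, hθ1⟩
    have h1 := hzmin _ ⟨hmem.1, by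
      rw [map_add, map_smul, map_sub, hBT, hzC.2, sub_self, smul_zero, add_zero]⟩
    rw [hsupz, iSup_penalizedEnergy hAnn hlam.1 hmem, ENNReal.ofReal_le_ofReal_iff
      (add_nonneg (hAnn _) (integral_mul_norm_sq_nonneg hlam.1 _))] at h1
    exact h1
  · obtain ⟨w, hw, hw'⟩ := exists_recovery_curvature hS hlam hzcone
    set Q : ℝ := ∫ x, lam x * ‖D (z x)‖ ^ 2 ∂μ with hQ
    let σ : ℝ → StressSpace μ m := fun t => t⁻¹ • (sol (ℓ₀ + t • q t) - S)
    -- the recovery directions, corrected to match the perturbed load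
    let y : ℝ → StressSpace μ m := fun t => w t + R (q t - B (w t))
    let r : ℝ → StressSpace μ m := fun t => R (δℓ - q t)
    have hy : Tendsto y (𝓝[>] 0) (𝓝 z) := by
      have h1 := hw.add ((R.continuous.tendsto _).comp
        (hq.sub ((B.continuous.tendsto z).comp hw)))
      rw [hzC.2, sub_self, map_zero, add_zero] at h1
      exact h1
    have hr : Tendsto r (𝓝[>] 0) (𝓝 0) := by
      have h1 := (R.continuous.tendsto _).comp ((tendsto_const_nhds (x := δℓ)).sub hq)
      rw [sub_self, map_zero] at h1
      exact h1
    have hσsol : ∀ t, 0 < t → IsStressSolution A B D (ℓ₀ + t • q t) (S + t • σ t) := by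
      intro t ht
      have h1 : S + t • σ t = sol (ℓ₀ + t • q t) := by
        simp only [σ]
        rw [smul_inv_smul₀ ht.ne']
        abel
      rw [h1]
      exact hsol _
    have hBσ : ∀ t, 0 < t → B (σ t) = q t := by
      intro t ht
      have h := (hσsol t ht).2.1
      rw [map_add, hBS, map_smul] at h
      exact smul_right_injective _ ht.ne' (add_left_cancel h)
    have henergy : ∀ t, 0 < t → A (σ t) (σ t) + -2 * Ξ (σ t) / t ≤ A (y t) (y t) + Q := by
      intro t ht
      have hyK : S + t • y t ∈ admissibleSet μ D := by
        simp only [y]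
        rw [smul_add, ← add_assoc, ← map_smul]
        exact add_mem_admissibleSet (hw' t ht).1 (hR _).1
      have hBy : B (y t) = q t := by
        simp only [y]
        rw [map_add, (hR _).2]
        abel
      refine (energy_le_of_isStressSolution (u := u) hAsymm hBS ht (hσsol t ht) hyK hBy).trans ?_
      have h1 : Ξ (y t) = Ξ (w t) := by
        simp only [y]
        rw [map_add, hlam.map_deviatorKernel (hR _).1, add_zero]
      have h2 := (hw' t ht).2
      rw [← h1] at h2
      linarith
    have hσT : ∀ t, 0 < t → σ t ∈ tangentDirections D S ∧
        curvature D lam (σ t) ≤ ENNReal.ofReal (-2 * Ξ (σ t) / t) := fun t ht =>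
      curvature_le_of_admissible hS hlam ht (hσsol t ht).1
    have hΞσ : ∀ t, 0 < t → 0 ≤ -Ξ (σ t) := fun t ht =>
      neg_nonneg.2 (nonpos_of_mem_tangentDirections hS hΞ (hσT t ht).1)
    -- the shift by `r t` restores the exact load `δℓ` and costs an energy that tends to zero
    let bound : ℝ → ℝ := fun t => A (y t) (y t) + Q +
      (2 * (‖A‖ * √((A (y t) (y t) + Q) / c) * ‖r t‖) + A (r t) (r t))
    have hAc : Continuous fun S : StressSpace μ m => A S S :=
      A.continuous.clm_apply continuous_id
    have hbound : Tendsto bound (𝓝[>] 0) (𝓝 (A z z + Q)) := by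
      have h1 : Tendsto (fun t => A (y t) (y t) + Q) (𝓝[>] 0) (𝓝 (A z z + Q)) :=
        ((hAc.tendsto z).comp hy).add_const Q
      have h2 := ((((h1.div_const c).sqrt.const_mul ‖A‖).mul hr.norm).const_mul 2).add
        ((hAc.tendsto 0).comp hr)
      have h3 := h1.add h2
      simpa using h3
    have hxenergy : ∀ t, 0 < t →
        A (σ t + r t) (σ t + r t) + -2 * Ξ (σ t) / t ≤ bound t := by
      intro t ht
      have h1 := henergy t ht
      have h2 : 0 ≤ -2 * Ξ (σ t) / t := div_nonneg (by have := hΞσ t ht; linarith) ht.le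
      have h3 : ‖σ t‖ ≤ √((A (y t) (y t) + Q) / c) := by
        refine Real.le_sqrt_of_sq_le ?_
        rw [le_div_iff₀ hc]
        have := hA (σ t)
        linarith
      have h4 : A (σ t) (r t) ≤ ‖A‖ * √((A (y t) (y t) + Q) / c) * ‖r t‖ :=
        calc A (σ t) (r t) ≤ ‖A (σ t) (r t)‖ := Real.le_norm_self _
          _ ≤ ‖A‖ * ‖σ t‖ * ‖r t‖ := A.le_opNorm₂ _ _
          _ ≤ _ := by gcongr
      have h5 : A (σ t + r t) (σ t + r t) =
          A (σ t) (σ t) + 2 * A (σ t) (r t) + A (r t) (r t) := by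
        have := hAsymm (r t) (σ t)
        simp only [map_add, add_apply, this]
        ring
      simp only [bound]
      rw [h5]
      linarith
    have hx : Tendsto (fun t => σ t + r t) (𝓝[>] 0) (𝓝 z) := by
      refine hzconv _ _ ?_ fun N ε hε => ?_
      · filter_upwards [self_mem_nhdsWithin] with t ht
        refine ⟨add_mem_tangentDirections (hσT t ht).1 (hR _).1, ?_⟩
        rw [map_add, hBσ t ht, (hR _).2]
        abel
      · have hNt : ∀ᶠ t : ℝ in 𝓝[>] 0, t * N < 2 := by
          have : Tendsto (fun t : ℝ => t * N) (𝓝[>] 0) (𝓝 (0 * N)) :=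
            (Continuous.tendsto (by fun_prop) 0).mono_left nhdsWithin_le_nhds
          rw [zero_mul] at this
          exact this.eventually (gt_mem_nhds two_pos)
        filter_upwards [self_mem_nhdsWithin, hNt,
          hbound.eventually (gt_mem_nhds (lt_add_of_pos_right (A z z + Q) hε))] with t ht hN hb
        have ht : 0 < t := ht
        have h2 : 0 ≤ -2 * Ξ (σ t) / t := div_nonneg (by have := hΞσ t ht; linarith) ht.le
        have h3 : curvature D lam (σ t + r t) = curvature D lam (σ t) :=
          curvature_eq_of_ae (map_add_deviatorKernel_ae _ (hR _).1)
        have h4 : Ξ (σ t + r t) = Ξ (σ t) := by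
          rw [map_add, hlam.map_deviatorKernel (hR _).1, add_zero]
        have h5 : (N : ENNReal) * ENNReal.ofReal (-Ξ (σ t)) ≤
            ENNReal.ofReal (-2 * Ξ (σ t) / t) := by
          rw [← ENNReal.ofReal_natCast, ← ENNReal.ofReal_mul (Nat.cast_nonneg N)]
          refine ENNReal.ofReal_le_ofReal ?_
          rw [le_div_iff₀ ht]
          nlinarith [mul_nonneg (hΞσ t ht) (sub_nonneg.2 hN.le)]
        calc penalizedEnergy A D Ξ lam N (σ t + r t)
            ≤ ENNReal.ofReal (A (σ t + r t) (σ t + r t)) +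
              ENNReal.ofReal (-2 * Ξ (σ t) / t) := by
              unfold penalizedEnergy
              rw [h3, h4]
              gcongr
              exact sup_le (hσT t ht).2 h5
          _ = ENNReal.ofReal (A (σ t + r t) (σ t + r t) + -2 * Ξ (σ t) / t) :=
              (ENNReal.ofReal_add (hAnn _) h2).symm
          _ ≤ ENNReal.ofReal (A z z + Q + ε) :=
              ENNReal.ofReal_le_ofReal ((hxenergy t ht).trans hb.le)
          _ = _ := by
              rw [hsupz, ENNReal.ofReal_add
                (add_nonneg (hAnn z) (integral_mul_norm_sq_nonneg hlam.1 z)) hε.le]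
    have hfinal := hx.sub hr
    simpa only [add_sub_cancel_right, sub_zero] using hfinal

end Derivative

/-! ### The linearized saddle-point inequality -/

section Linearized

variable {Ω : Type*} [MeasurableSpace Ω] {μ : Measure Ω} {m n : ℕ} {V : Type*}
  [NormedAddCommGroup V] [InnerProductSpace ℝ V]
  {A : StressSpace μ m →L[ℝ] StrongDual ℝ (StressSpace μ m)}
  {B : StressSpace μ m →L[ℝ] StrongDual ℝ V}
  {D : EuclideanSpace ℝ (Fin m) →ₗ[ℝ] EuclideanSpace ℝ (Fin n)}
  {R : StrongDual ℝ V →L[ℝ] StressSpace μ m}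
  {S : StressSpace μ m} {Ξ : StrongDual ℝ (StressSpace μ m)} {lam : Lp ℝ 2 μ}

theorem integral_mul_inner_deviatorKernel (z : StressSpace μ m) {h : StressSpace μ m}
    (hh : h ∈ deviatorKernel μ D) : ∫ x, lam x * inner ℝ (D (z x)) (D (h x)) ∂μ = 0 := by
  refine integral_eq_zero_of_ae ?_
  filter_upwards [hh] with x hx
  simp [norm_eq_zero.1 hx]

/-- The linearized saddle-point inequality splits into the linearized equality constraint, the
formula for the multiplier, and a variational inequality for the stress alone. -/
theorem isLinearizedSolution_iff (hR : ∀ φ, R φ ∈ deviatorKernel μ D ∧ B (R φ) = φ)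
    (hlam : IsNormalMultiplier D S Ξ lam) {δℓ : StrongDual ℝ V} {z : StressSpace μ m} {u : V} :
    IsLinearizedSolution A B D (curvatureCone D S Ξ lam) lam δℓ z u ↔
      z ∈ curvatureCone D S Ξ lam ∧ B z = δℓ ∧ (∀ φ, φ u = -(A z (R φ))) ∧
        ∀ T ∈ curvatureCone D S Ξ lam, B T = δℓ →
          0 ≤ A z (T - z) + ∫ x, lam x * inner ℝ (D (z x)) (D ((T - z) x)) ∂μ := by
  constructor
  · rintro ⟨hz, h⟩
    have hBz : B z = δℓ := by
      have h1 : ∀ v, (B z - δℓ) v ≤ 0 := fun v => by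
        have h2 := h z hz (v + u)
        rw [sub_self, integral_mul_inner_deviatorKernel z (deviatorSubmodule μ D).zero_mem,
          map_zero, add_sub_cancel_right] at h2
        linarith
      ext v
      have h2 := h1 v
      have h3 := h1 (-v)
      rw [map_neg] at h3
      rw [sub_apply] at h2 h3
      linarith
    refine ⟨hz, hBz, ?_, fun T hT hBT => ?_⟩
    · have h1 : ∀ φ, 0 ≤ A z (R φ) + φ u := fun φ => by
        have h2 := h _ (add_mem_curvatureCone hlam hz (hR φ).1) u
        rw [add_sub_cancel_left, sub_self, map_zero, sub_zero,
          integral_mul_inner_deviatorKernel z (hR φ).1, add_zero, add_apply,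
          ContinuousLinearMap.flip_apply, (hR φ).2] at h2
        exact h2
      intro φ
      have h2 := h1 (-φ)
      rw [map_neg, map_neg, neg_apply] at h2
      linarith [h1 φ]
    · have h1 := h T hT u
      rwa [sub_self, map_zero, sub_zero, add_apply, ContinuousLinearMap.flip_apply, map_sub B, hBT,
        hBz, sub_self, zero_apply, add_zero] at h1
  · rintro ⟨hz, hBz, hu, h⟩
    refine ⟨hz, fun T hT v => ?_⟩
    -- correct `T` by a kernel direction, which affects neither the cone nor the curvature
    have h1 := h _ (add_mem_curvatureCone hlam hT (hR (δℓ - B T)).1)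
      (by rw [map_add, (hR _).2]; abel)
    have h2 : ∫ x, lam x * inner ℝ (D (z x)) (D ((T + R (δℓ - B T) - z) x)) ∂μ =
        ∫ x, lam x * inner ℝ (D (z x)) (D ((T - z) x)) ∂μ := by
      refine integral_congr_ae ?_
      filter_upwards [map_sub_ae D (T + R (δℓ - B T)) z, map_sub_ae D T z,
        map_add_deviatorKernel_ae T (hR (δℓ - B T)).1] with x e1 e2 e3
      rw [e1, e2, e3]
    have h3 := hu (δℓ - B T)
    rw [h2] at h1
    simp only [hBz, sub_self, zero_apply, map_sub, map_add, add_apply, sub_apply,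
      ContinuousLinearMap.flip_apply] at h1 h3 ⊢
    linarith

end Linearized

end Elastoplasticity

end

theorem mainTheorem7 {Ω V : Type*} [MeasurableSpace Ω] (μ : Measure Ω) [SigmaFinite μ]
    [NormedAddCommGroup V] [InnerProductSpace ℝ V] [CompleteSpace V] (m n : ℕ)
    (A : Elastoplasticity.StressSpace μ m →L[ℝ] StrongDual ℝ (Elastoplasticity.StressSpace μ m))
    (B : Elastoplasticity.StressSpace μ m →L[ℝ] StrongDual ℝ V)
    (D : EuclideanSpace ℝ (Fin m) →ₗ[ℝ] EuclideanSpace ℝ (Fin n))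
    (hAsymm : ∀ S T, A S T = A T S)
    (hAcoer : IsCoercive A)
    (hB : Set.SurjOn B (Elastoplasticity.deviatorKernel μ D) Set.univ) :
    -- the solution map, pinned down by the minimization problem and the saddle-point inequality
    ∃ sol : StrongDual ℝ V → Elastoplasticity.StressSpace μ m × V,
      (∀ ℓ, (∀ S, Elastoplasticity.IsStressSolution A B D ℓ S ↔ S = (sol ℓ).1) ∧
        (∀ u, Elastoplasticity.SaddlePointVI A B D ℓ (sol ℓ).1 u ↔ u = (sol ℓ).2)) ∧
      ∀ ℓ₀ : StrongDual ℝ V,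
        ∃ lam₀ : Lp ℝ 2 μ,
          (∀ lam, Elastoplasticity.IsPlasticMultiplier A B D (sol ℓ₀).1 (sol ℓ₀).2 lam ↔
            lam = lam₀) ∧
          -- the curvature integrals are well defined on the reduced critical cone
          (∀ T₁ ∈ Elastoplasticity.plasticCone A B D (sol ℓ₀).1 (sol ℓ₀).2,
            ∀ T₂ ∈ Elastoplasticity.plasticCone A B D (sol ℓ₀).1 (sol ℓ₀).2,
              Integrable (fun x => lam₀ x * inner ℝ (D (T₁ x)) (D (T₂ x))) μ) ∧
          ∀ δℓ : StrongDual ℝ V,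
            ∃ y : Elastoplasticity.StressSpace μ m × V,
              Elastoplasticity.HasHadamardDirDeriv sol ℓ₀ δℓ y ∧
              ∀ S' u', Elastoplasticity.IsLinearizedSolution A B D
                (Elastoplasticity.plasticCone A B D (sol ℓ₀).1 (sol ℓ₀).2) lam₀ δℓ S' u' ↔
                  (S', u') = y := by
  open Elastoplasticity in
  obtain ⟨c, hc, hA'⟩ := hAcoer
  have hA : ∀ x, c * ‖x‖ ^ 2 ≤ A x x := fun x => by
    rw [pow_two, ← mul_assoc]
    exact hA' x
  obtain ⟨R, hR⟩ := exists_rightInverse_deviatorKernel hB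
  obtain ⟨U, hU⟩ := exists_multiplierMap A R
  choose σ hσ using exists_isStressSolution hc hA hR
  have hUeq : ∀ S u, (∀ φ, φ u = -(A S (R φ))) ↔ u = U S := fun S u =>
    ⟨fun h => eq_of_forall_strongDual_eq fun φ => (h φ).trans (hU S φ).symm,
      fun h φ => h ▸ hU S φ⟩
  refine ⟨fun ℓ => (σ ℓ, U (σ ℓ)), fun ℓ => ⟨fun S =>
    ⟨fun h => h.unique hAsymm hc hA (hσ ℓ), fun h => h ▸ hσ ℓ⟩,
    fun u => (saddlePointVI_iff hAsymm hR (hσ ℓ)).trans (hUeq _ _)⟩, fun ℓ₀ => ?_⟩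
  have hS := (hσ ℓ₀).1
  have hΞ : ∀ T ∈ admissibleSet μ D,
      (-(A (σ ℓ₀) + B.flip (U (σ ℓ₀)))) (T - σ ℓ₀) ≤ 0 := fun T hT => by
    rw [neg_apply]
    exact neg_nonpos.2 (nonneg_of_multiplier hAsymm hR (hσ ℓ₀) (hU _) hT)
  obtain ⟨lam, hlam⟩ := exists_isNormalMultiplier hS hΞ
  have hcone : plasticCone A B D (σ ℓ₀) (U (σ ℓ₀)) =
      curvatureCone D (σ ℓ₀) (-(A (σ ℓ₀) + B.flip (U (σ ℓ₀)))) lam :=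
    reducedCriticalCone_eq_curvatureCone hS hΞ hlam
  refine ⟨lam, fun lam' => isPlasticMultiplier_iff.trans
    ⟨fun h => h.unique hS hlam, fun h => h ▸ hlam⟩, ?_, fun δℓ => ?_⟩
  · simp only [hcone]
    exact fun T₁ h₁ T₂ h₂ => integrable_mul_inner_of_curvature hlam.1 h₁.2.2 h₂.2.2
  · obtain ⟨z, hz, hBz, hzVI, hzder⟩ :=
      exists_stress_derivative hAsymm hc hA hR hσ hΞ hlam δℓ
    refine ⟨(z, U z), fun q hq => ?_, fun S' u' => ?_⟩
    · have h1 := hzder q hq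
      have h2 := (U.continuous.tendsto z).comp h1
      refine (h1.prodMk_nhds h2).congr fun t => ?_
      simp only [Function.comp_apply, map_smul, map_sub, Prod.mk_sub_mk, Prod.smul_mk]
    · simp only [hcone]
      rw [isLinearizedSolution_iff hR hlam, Prod.mk.injEq]
      constructor
      · rintro ⟨h1, h2, h3, h4⟩
        have h5 : S' = z := eq_of_linearized hc hA hlam.1 h1.2.2 hz.2.2 (h4 z hz hBz)
          (hzVI S' h1 h2)
        exact ⟨h5, h5 ▸ (hUeq _ _).1 h3⟩
      · rintro ⟨rfl, rfl⟩
        exact ⟨hz, hBz, hU S', hzVI⟩
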